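/- Let $V$ be a finite-dimensional real Euclidean space with inner product $\langle\cdot,\cdot\rangle$, let $d\mu(v)=A^{-1}e^{-\langle v,v\rangle/2}\,dv$ (with $A=\int_V e^{-\langle v,v\rangle/2}dv$) be its Gaussian probability measure, put $V_{\mathbb C}=V\otimes\mathbb C$, and let $T_k:V_{\mathbb C}^{\otimes k}\to\mathbb C$ ($k=1,2,\dots$) be linear maps with $T_k(w_1\otimes\dots\otimes w_k)=T_k(w_k\otimes w_1\otimes\dots\otimes w_{k-1})$. A closed ribbon graph $\Gamma$ is a finite graph (possibly empty or disconnected; loops and multiple edges are allowed; every vertex has valence at least $1$) with a cyclic order on the half-edges at each vertex. Equivalently, it is a finite set of half-edges with a permutation whose cycles are the vertices and a fixed-point-free involution whose orbits are the edges. Isomorphisms are the bijections of half-edges that respect both, and $\operatorname{Aut}\Gamma$ is the group of automorphisms. For coefficients $x_*=(x_1,x_2,\dots)$ let $Z_{x_*}(\Gamma)$ be the value on $\Gamma$ of the graphical calculus of the cyclic algebra $(V_{\mathbb C},\langle\cdot,\cdot\rangle,x_1T_1,x_2T_2,\dots)$: put $x_kT_k$ on each $k$-valent vertex, its arguments being ordered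 according to the cyclic order, put the Casimir element $\sum_{i,j} g^{ij}e_i\otimes e_j$ on each edge, where $(e_i)$ is any basis of $V$ and $(g^{ij})$ is the inverse of the matrix $(\langle e_i,e_j\rangle)$, and contract along the half-edges. Then $$\int_V \exp\Bigl\{\sum_{k=1}^\infty x_k\frac{T_k(v^{\otimes k})}{k}\Bigr\}\,d\mu(v)=\sum_{\Gamma}\frac{Z_{x_*}(\Gamma)}{|\operatorname{Aut}\Gamma|}$$ as an asymptotic expansion, where $\Gamma$ runs over all isomorphism classes of closed ribbon graphs. This means the following. (1) The identity holds between formal power series in the infinitely many variables $x_1,x_2,\dots$, when the exponential is expanded as a formal power series and integrated coefficient by coefficient. For each monomial, the coefficient on the left is an integrable function of $v$, and only finitely many $\Gamma$ contribute on the right. (2) For every finite set $K$ of indices, every $n\ge 0$ and all real $r<1$ and $B$ there is a constant $C$ such that, for all complex $x_*$ with $x_k=0$ for $k\notin K$ and $$\operatorname{Re}\sum_k x_k\frac{T_k(v^{\otimes k})}{k}\le r\,\frac{\langle v,v\rangle}{2}+B\quad\text{for all }v\in V,$$ the integrand is $\mu$-integrable, only finitely many $\Gamma$ with at most $n$ vertices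 have $Z_{x_*}(\Gamma)\ne0$, and $$\Bigl|\int_V \exp\Bigl\{\sum_k x_k\frac{T_k(v^{\otimes k})}{k}\Bigr\}d\mu(v)-\sum_{|\mathrm{Vert}(\Gamma)|\le n}\frac{Z_{x_*}(\Gamma)}{|\operatorname{Aut}\Gamma|}\Bigr|\le C\Bigl(\sum_{k\in K}|x_k|\Bigr)^{n+1}.$$ -/

import Mathlib

open MeasureTheory
open scoped TensorProduct

noncomputable section

/-! ## Gaussian measure -/

/-- The Gaussian probability measure `A⁻¹ exp(-⟨v,v⟩/2) dv` on a Euclidean space `V`,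
where `A = ∫ exp(-⟨v,v⟩/2) dv`. -/
def gaussianMeasure (V : Type*) [NormedAddCommGroup V] [InnerProductSpace ℝ V]
    [FiniteDimensional ℝ V] [MeasurableSpace V] [BorelSpace V] : Measure V :=
  (∫⁻ v : V, ENNReal.ofReal (Real.exp (-(inner ℝ v v) / 2)))⁻¹ •
    (volume : Measure V).withDensity
      (fun v => ENNReal.ofReal (Real.exp (-(inner ℝ v v) / 2)))

/-! ## Ribbon graphs of type `(0,0)` -/

/-- A ribbon graph of type `(0,0)`, possibly disconnected, with set of half-edges `H`:
`rot` sends a half-edge to the next one in the cyclic order at its vertex (so that the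
vertices are the cycles of `rot`, fixed points included), and `flip` sends a half-edge to the
other half of its edge. -/
structure RibbonGraph (H : Type*) where
  rot : Equiv.Perm H
  flip : Equiv.Perm H
  flip_flip : ∀ h, flip (flip h) = h
  flip_ne : ∀ h, flip h ≠ h

namespace RibbonGraph

variable {H H' H'' : Type*}

/-- The vertices: orbits of half-edges under rotation. -/
def Vertex (Γ : RibbonGraph H) : Type _ := Quotient (Equiv.Perm.SameCycle.setoid Γ.rot)

/-- The edges: orbits of half-edges under the flip. -/
def Edge (Γ : RibbonGraph H) : Type _ := Quotient (Equiv.Perm.SameCycle.setoid Γ.flip)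

/-- The vertex from which a half-edge stems. -/
def vertexOf (Γ : RibbonGraph H) (h : H) : Γ.Vertex := Quotient.mk _ h

/-- The edge to which a half-edge belongs. -/
def edgeOf (Γ : RibbonGraph H) (h : H) : Γ.Edge := Quotient.mk _ h

/-- A half-edge at the vertex `v`. -/
def baseOf (Γ : RibbonGraph H) (v : Γ.Vertex) : H := Quotient.out v

/-- One of the two halves of the edge `e`. -/
def halfOf (Γ : RibbonGraph H) (e : Γ.Edge) : H := Quotient.out e

@[simp] lemma vertexOf_baseOf (Γ : RibbonGraph H) (v : Γ.Vertex) :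
    Γ.vertexOf (Γ.baseOf v) = v := Quotient.out_eq v

@[simp] lemma edgeOf_halfOf (Γ : RibbonGraph H) (e : Γ.Edge) :
    Γ.edgeOf (Γ.halfOf e) = e := Quotient.out_eq e

lemma vertexOf_eq_iff (Γ : RibbonGraph H) {h h' : H} :
    Γ.vertexOf h = Γ.vertexOf h' ↔ Γ.rot.SameCycle h h' := Quotient.eq

lemma edgeOf_eq_iff (Γ : RibbonGraph H) {h h' : H} :
    Γ.edgeOf h = Γ.edgeOf h' ↔ Γ.flip.SameCycle h h' := Quotient.eq

instance [Finite H] (Γ : RibbonGraph H) : Finite Γ.Vertex :=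
  inferInstanceAs (Finite (Quotient _))

instance [Finite H] (Γ : RibbonGraph H) : Finite Γ.Edge :=
  inferInstanceAs (Finite (Quotient _))

instance [Finite H] (Γ : RibbonGraph H) : Fintype Γ.Vertex := Fintype.ofFinite _

instance [Finite H] (Γ : RibbonGraph H) : Fintype Γ.Edge := Fintype.ofFinite _

/-- The valence of a vertex: the number of half-edges stemming from it. -/
def valence [Finite H] (Γ : RibbonGraph H) (v : Γ.Vertex) : ℕ+ :=
  ⟨Nat.card {h : H // Γ.vertexOf h = v},
    haveI : Nonempty {h : H // Γ.vertexOf h = v} := ⟨⟨Γ.baseOf v, Γ.vertexOf_baseOf v⟩⟩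
    Nat.card_pos⟩

/-- The number of vertices. -/
def numVertices (Γ : RibbonGraph H) : ℕ := Nat.card Γ.Vertex

/-- A bijection of half-edges is an isomorphism of ribbon graphs if it respects the cyclic
orders at the vertices and the pairing of half-edges into edges. -/
def IsIso (Γ : RibbonGraph H) (Γ' : RibbonGraph H') (φ : H ≃ H') : Prop :=
  (∀ h, φ (Γ.rot h) = Γ'.rot (φ h)) ∧ ∀ h, φ (Γ.flip h) = Γ'.flip (φ h)

/-- The automorphisms of a ribbon graph. -/
def Aut (Γ : RibbonGraph H) : Type _ := {φ : H ≃ H // Γ.IsIso Γ φ}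

lemma IsIso.refl (Γ : RibbonGraph H) : Γ.IsIso Γ (Equiv.refl H) :=
  ⟨fun _ => rfl, fun _ => rfl⟩

lemma IsIso.symm {Γ : RibbonGraph H} {Γ' : RibbonGraph H'} {φ : H ≃ H'} (hφ : Γ.IsIso Γ' φ) :
    Γ'.IsIso Γ φ.symm :=
  ⟨fun h => by rw [Equiv.symm_apply_eq, hφ.1, Equiv.apply_symm_apply],
   fun h => by rw [Equiv.symm_apply_eq, hφ.2, Equiv.apply_symm_apply]⟩

lemma IsIso.trans {Γ : RibbonGraph H} {Γ' : RibbonGraph H'} {Γ'' : RibbonGraph H''}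
    {φ : H ≃ H'} {ψ : H' ≃ H''} (hφ : Γ.IsIso Γ' φ) (hψ : Γ'.IsIso Γ'' ψ) :
    Γ.IsIso Γ'' (φ.trans ψ) :=
  ⟨fun h => by simp [hφ.1, hψ.1], fun h => by simp [hφ.2, hψ.2]⟩

lemma sameCycle_map {f : Equiv.Perm H} {g : Equiv.Perm H'} {φ : H ≃ H'}
    (hφ : ∀ h, φ (f h) = g (φ h)) (h h' : H) :
    f.SameCycle h h' ↔ g.SameCycle (φ h) (φ h') := by
  have hg : g = φ.permCongr f := by
    ext x
    simp [Equiv.permCongr_apply, hφ]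
  have hz : ∀ n : ℤ, φ ((f ^ n) h) = (g ^ n) (φ h) := by
    intro n
    have hp : (φ.permCongr f) ^ n = φ.permCongr (f ^ n) :=
      (map_zpow φ.permCongrHom f n).symm
    rw [hg, hp]
    simp [Equiv.permCongr_apply]
  constructor
  · rintro ⟨n, rfl⟩
    exact ⟨n, (hz n).symm⟩
  · rintro ⟨n, hn⟩
    exact ⟨n, φ.injective ((hz n).trans hn)⟩

/-- The bijection on vertices induced by an isomorphism. -/
def IsIso.vertexEquiv {Γ : RibbonGraph H} {Γ' : RibbonGraph H'} {φ : H ≃ H'}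
    (hφ : Γ.IsIso Γ' φ) : Γ.Vertex ≃ Γ'.Vertex :=
  Quotient.congr φ (sameCycle_map hφ.1)

/-- The bijection on edges induced by an isomorphism. -/
def IsIso.edgeEquiv {Γ : RibbonGraph H} {Γ' : RibbonGraph H'} {φ : H ≃ H'}
    (hφ : Γ.IsIso Γ' φ) : Γ.Edge ≃ Γ'.Edge :=
  Quotient.congr φ (sameCycle_map hφ.2)

lemma IsIso.vertexEquiv_vertexOf {Γ : RibbonGraph H} {Γ' : RibbonGraph H'} {φ : H ≃ H'}
    (hφ : Γ.IsIso Γ' φ) (h : H) : hφ.vertexEquiv (Γ.vertexOf h) = Γ'.vertexOf (φ h) := rfl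

lemma IsIso.edgeEquiv_edgeOf {Γ : RibbonGraph H} {Γ' : RibbonGraph H'} {φ : H ≃ H'}
    (hφ : Γ.IsIso Γ' φ) (h : H) : hφ.edgeEquiv (Γ.edgeOf h) = Γ'.edgeOf (φ h) := rfl

lemma IsIso.valence_eq [Finite H] [Finite H'] {Γ : RibbonGraph H} {Γ' : RibbonGraph H'}
    {φ : H ≃ H'} (hφ : Γ.IsIso Γ' φ) (v : Γ.Vertex) :
    Γ'.valence (hφ.vertexEquiv v) = Γ.valence v := by
  apply PNat.coe_injective
  refine (Nat.card_congr (φ.subtypeEquiv fun h => ?_)).symm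
  rw [← hφ.vertexEquiv_vertexOf, hφ.vertexEquiv.apply_eq_iff_eq]

lemma IsIso.numVertices_eq {Γ : RibbonGraph H} {Γ' : RibbonGraph H'} {φ : H ≃ H'}
    (hφ : Γ.IsIso Γ' φ) : Γ.numVertices = Γ'.numVertices :=
  Nat.card_congr hφ.vertexEquiv

lemma IsIso.card_aut_eq {Γ : RibbonGraph H} {Γ' : RibbonGraph H'} {φ : H ≃ H'}
    (hφ : Γ.IsIso Γ' φ) : Nat.card Γ.Aut = Nat.card Γ'.Aut := by
  refine Nat.card_congr
    { toFun := fun ψ => ⟨(φ.symm.trans ψ.1).trans φ, (hφ.symm.trans ψ.2).trans hφ⟩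
      invFun := fun ψ => ⟨(φ.trans ψ.1).trans φ.symm, (hφ.trans ψ.2).trans hφ.symm⟩
      left_inv := fun ψ => Subtype.ext (by ext h; simp)
      right_inv := fun ψ => Subtype.ext (by ext h; simp) }

/-- Ribbon graphs with finitely many half-edges, the half-edges being labelled by some
`Fin n`. The labels are forgotten by passing to isomorphism classes. -/
def Labelled : Type := Σ n : ℕ, RibbonGraph (Fin n)

/-- Isomorphism of ribbon graphs, as an equivalence relation. -/
instance isoSetoid : Setoid Labelled where
  r Γ Γ' := ∃ φ : Fin Γ.1 ≃ Fin Γ'.1, Γ.2.IsIso Γ'.2 φ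
  iseqv :=
    { refl := fun Γ => ⟨_, IsIso.refl Γ.2⟩
      symm := fun ⟨_, hφ⟩ => ⟨_, hφ.symm⟩
      trans := fun ⟨_, hφ⟩ ⟨_, hψ⟩ => ⟨_, hφ.trans hψ⟩ }

/-- Every ribbon graph with finitely many half-edges is isomorphic to a labelled one. -/
lemma exists_labelled [Finite H] (Γ : RibbonGraph H) :
    ∃ (Γ' : Labelled) (φ : H ≃ Fin Γ'.1), Γ.IsIso Γ'.2 φ := by
  obtain ⟨n, ⟨φ⟩⟩ := Finite.exists_equiv_fin H
  refine ⟨⟨n, ⟨φ.permCongr Γ.rot, φ.permCongr Γ.flip, fun h => ?_, fun h => ?_⟩⟩, φ, ?_, ?_⟩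
  · simp [Equiv.permCongr_apply, Γ.flip_flip]
  · intro hh
    rw [Equiv.permCongr_apply, ← Equiv.eq_symm_apply] at hh
    exact Γ.flip_ne _ hh
  · intro h
    simp [Equiv.permCongr_apply]
  · intro h
    simp [Equiv.permCongr_apply]

end RibbonGraph

/-- The set of isomorphism classes of (possibly disconnected, possibly empty) finite ribbon
graphs of type `(0,0)`. -/
def RibbonClass : Type := Quotient RibbonGraph.isoSetoid

/-- The order of the automorphism group. -/
def RibbonClass.cardAut (Γ : RibbonClass) : ℕ :=
  Quotient.lift (s := RibbonGraph.isoSetoid) (fun Γ : RibbonGraph.Labelled => Nat.card Γ.2.Aut)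
    (fun _ _ h => h.elim fun _ hφ => hφ.card_aut_eq) Γ

/-- The number of vertices. -/
def RibbonClass.numVertices (Γ : RibbonClass) : ℕ :=
  Quotient.lift (s := RibbonGraph.isoSetoid) (fun Γ : RibbonGraph.Labelled => Γ.2.numVertices)
    (fun _ _ h => h.elim fun _ hφ => hφ.numVertices_eq) Γ

/-! ## Cyclic algebras and their graphical calculus -/

/-- A cyclic algebra structure on `V_ℂ = ℂ ⊗ V` (with the inner product of `V`): a sequence of
cyclically invariant linear maps `T k : V_ℂ^{⊗ k} → ℂ`, `k = 1, 2, …`, given as `ℂ`-multilinear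
maps. -/
structure CyclicAlgebra (V : Type*) [NormedAddCommGroup V] [InnerProductSpace ℝ V] where
  T : (k : ℕ+) → MultilinearMap ℂ (fun _ : Fin k => ℂ ⊗[ℝ] V) ℂ
  cyclic : ∀ (k : ℕ+) (w : Fin k → ℂ ⊗[ℝ] V), T k (fun i => w (finRotate k i)) = T k w

/-- The matrix `g^{ij}`, inverse of `g_{ij} = ⟨e_i, e_j⟩`; the Casimir element is
`∑ g^{ij} e_i ⊗ e_j`. -/
def casimirMatrix {V ι : Type*} [NormedAddCommGroup V] [InnerProductSpace ℝ V] [Fintype ι]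
    [DecidableEq ι] (b : Module.Basis ι ℝ V) : Matrix ι ι ℝ :=
  (Matrix.of fun i j => inner ℝ (b i) (b j))⁻¹

lemma casimirMatrix_symm {V ι : Type*} [NormedAddCommGroup V] [InnerProductSpace ℝ V]
    [Fintype ι] [DecidableEq ι] (b : Module.Basis ι ℝ V) (i j : ι) :
    casimirMatrix b i j = casimirMatrix b j i := by
  have h : (casimirMatrix b).transpose = casimirMatrix b := by
    rw [casimirMatrix, Matrix.transpose_nonsing_inv]
    congr 1
    ext i j
    exact real_inner_comm _ _
  exact congrFun (congrFun h j) i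

namespace CyclicAlgebra

variable {V : Type*} [NormedAddCommGroup V] [InnerProductSpace ℝ V]

/-- The function `v ↦ T k (v^{⊗ k})` on real vectors. -/
def diag (A : CyclicAlgebra V) (k : ℕ+) (v : V) : ℂ := A.T k fun _ => (1 : ℂ) ⊗ₜ[ℝ] v

/-- `T k (e_{c(h)} ⊗ e_{c(h')} ⊗ ⋯)`, where `h, h', …` are the half-edges at the vertex `v`,
enumerated in their cyclic order. -/
def vertexFactor {ι H : Type*} [Finite H] (A : CyclicAlgebra V) (b : Module.Basis ι ℝ V) (Γ : RibbonGraph H)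
    (c : H → ι) (v : Γ.Vertex) : ℂ :=
  A.T (Γ.valence v) fun j => (1 : ℂ) ⊗ₜ[ℝ] b (c ((Γ.rot ^ (j : ℕ)) (Γ.baseOf v)))

/-- `g^{c(h) c(h')}`, where `h, h'` are the two halves of the edge `e`. -/
def edgeFactor {ι H : Type*} [Fintype ι] [DecidableEq ι] (b : Module.Basis ι ℝ V)
    (Γ : RibbonGraph H) (c : H → ι) (e : Γ.Edge) : ℝ :=
  casimirMatrix b (c (Γ.halfOf e)) (c (Γ.flip (Γ.halfOf e)))

/-- The value on the ribbon graph `Γ` of the graphical calculus for the cyclic algebra with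
tensors `x 1 • T 1, x 2 • T 2, …`: place the tensor `x k • T k` at each `k`-valent vertex, the
Casimir element `∑ g^{ij} e_i ⊗ e_j` at each edge, and contract along the half-edges. The
coefficients `x k` are taken in a commutative `ℂ`-algebra `R`, so that they can be numbers or
formal variables. -/
def graphZ {ι R H : Type*} [Fintype ι] [DecidableEq ι] [CommRing R] [Algebra ℂ R] [Fintype H]
    [DecidableEq H] (A : CyclicAlgebra V) (b : Module.Basis ι ℝ V) (x : ℕ+ → R)
    (Γ : RibbonGraph H) : R :=
  ∑ c : H → ι,
    (∏ e : Γ.Edge, algebraMap ℂ R (edgeFactor b Γ c e : ℂ)) *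
      ∏ v : Γ.Vertex, (x (Γ.valence v) * algebraMap ℂ R (A.vertexFactor b Γ c v))

lemma tensor_shift (A : CyclicAlgebra V) (k : ℕ+) (f : ℕ → ℂ ⊗[ℝ] V)
    (hf : ∀ i, f (i + k) = f i) (n : ℕ) :
    A.T k (fun j : Fin k => f (j + n)) = A.T k (fun j : Fin k => f j) := by
  induction n with
  | zero => rfl
  | succ n ih =>
    rw [← ih, ← A.cyclic k (fun j : Fin k => f (j + n))]
    congr 1
    funext j
    obtain ⟨m, hm⟩ : ∃ m, (k : ℕ) = m + 1 := ⟨k - 1, by have := k.pos; omega⟩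
    clear ih
    generalize (k : ℕ) = K at hf j hm
    subst hm
    by_cases hj : j = Fin.last m
    · subst hj
      rw [finRotate_last]
      simp only [Fin.val_last, Fin.val_zero, zero_add]
      rw [← hf n]
      congr 1
      omega
    · rw [coe_finRotate_of_ne_last hj]
      congr 1
      omega

lemma rot_pow_valence {H : Type*} [Finite H] (Γ : RibbonGraph H) (h : H) :
    (Γ.rot ^ (Γ.valence (Γ.vertexOf h) : ℕ)) h = h := by
  have hc : (Γ.valence (Γ.vertexOf h) : ℕ) = Function.minimalPeriod (Γ.rot • ·) h := by
    have : Fintype (MulAction.orbit (Subgroup.zpowers Γ.rot) h) := Fintype.ofFinite _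
    rw [MulAction.minimalPeriod_eq_card, ← Nat.card_eq_fintype_card]
    refine Nat.card_congr (Equiv.subtypeEquivRight fun h' => ?_)
    rw [Γ.vertexOf_eq_iff, MulAction.mem_orbit_iff]
    constructor
    · intro hs
      obtain ⟨n, hn⟩ := hs.symm
      exact ⟨⟨Γ.rot ^ n, n, rfl⟩, hn⟩
    · rintro ⟨⟨_, n, rfl⟩, hn⟩
      exact Equiv.Perm.SameCycle.symm ⟨n, hn⟩
  have hp := Function.isPeriodicPt_minimalPeriod (Γ.rot • · : H → H) h
  rw [← hc, Function.IsPeriodicPt, Function.IsFixedPt] at hp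
  rw [← Equiv.Perm.iterate_eq_pow]
  exact hp

lemma tensor_base {H : Type*} [Finite H] (A : CyclicAlgebra V) (Γ : RibbonGraph H) (w : H → ℂ ⊗[ℝ] V) {h h' : H}
    (hh : Γ.vertexOf h = Γ.vertexOf h') (k : ℕ+) (hk : k = Γ.valence (Γ.vertexOf h)) :
    A.T k (fun j : Fin k => w ((Γ.rot ^ (j : ℕ)) h')) =
      A.T k (fun j : Fin k => w ((Γ.rot ^ (j : ℕ)) h)) := by
  obtain ⟨n, -, rfl⟩ := ((Γ.vertexOf_eq_iff).1 hh).exists_pow_eq'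
  rw [← A.tensor_shift k (fun j => w ((Γ.rot ^ j) h)) (fun i => ?_) n]
  · simp only [pow_add, Equiv.Perm.mul_apply]
  · rw [pow_add, Equiv.Perm.mul_apply, hk, rot_pow_valence]

lemma vertexFactor_iso {ι H H' : Type*} [Finite H] [Finite H'] (A : CyclicAlgebra V)
    (b : Module.Basis ι ℝ V) {Γ : RibbonGraph H}
    {Γ' : RibbonGraph H'} {φ : H ≃ H'} (hφ : Γ.IsIso Γ' φ) (c : H' → ι) (v : Γ.Vertex) :
    A.vertexFactor b Γ' c (hφ.vertexEquiv v) = A.vertexFactor b Γ (c ∘ φ) v := by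
  have hz : ∀ (n : ℕ) (h : H), (Γ'.rot ^ n) (φ h) = φ ((Γ.rot ^ n) h) := by
    intro n h
    induction n with
    | zero => rfl
    | succ n ih => rw [pow_succ', pow_succ', Equiv.Perm.mul_apply, Equiv.Perm.mul_apply, ih, hφ.1]
  have hb : Γ'.vertexOf (φ (Γ.baseOf v)) = Γ'.vertexOf (Γ'.baseOf (hφ.vertexEquiv v)) := by
    rw [RibbonGraph.vertexOf_baseOf, ← hφ.vertexEquiv_vertexOf, RibbonGraph.vertexOf_baseOf]
  have hv : Γ.valence v = Γ'.valence (Γ'.vertexOf (φ (Γ.baseOf v))) := by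
    rw [hb, RibbonGraph.vertexOf_baseOf, hφ.valence_eq]
  unfold vertexFactor
  rw [hφ.valence_eq]
  rw [A.tensor_base Γ' (fun h => (1 : ℂ) ⊗ₜ[ℝ] b (c h)) hb _ hv]
  simp only [hz, Function.comp_apply]

lemma edgeFactor_iso {ι H H' : Type*} [Fintype ι] [DecidableEq ι] [Finite H']
    (b : Module.Basis ι ℝ V) {Γ : RibbonGraph H} {Γ' : RibbonGraph H'}
    {φ : H ≃ H'} (hφ : Γ.IsIso Γ' φ) (c : H' → ι) (e : Γ.Edge) :
    edgeFactor b Γ' c (hφ.edgeEquiv e) = edgeFactor b Γ (c ∘ φ) e := by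
  have hb : Γ'.edgeOf (φ (Γ.halfOf e)) = Γ'.edgeOf (Γ'.halfOf (hφ.edgeEquiv e)) := by
    rw [RibbonGraph.edgeOf_halfOf, ← hφ.edgeEquiv_edgeOf, RibbonGraph.edgeOf_halfOf]
  obtain ⟨n, -, hn⟩ := ((Γ'.edgeOf_eq_iff).1 hb).exists_pow_eq'
  unfold edgeFactor
  rw [← hn]
  have hcases : ∀ (n : ℕ) (h : H'), (Γ'.flip ^ n) h = h ∨ (Γ'.flip ^ n) h = Γ'.flip h := by
    intro n h
    induction n with
    | zero => exact Or.inl rfl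
    | succ n ih =>
      rw [pow_succ', Equiv.Perm.mul_apply]
      rcases ih with ih | ih
      · exact Or.inr (by rw [ih])
      · exact Or.inl (by rw [ih, Γ'.flip_flip])
  rcases hcases n (φ (Γ.halfOf e)) with h | h
  · rw [h, ← hφ.2]
    rfl
  · rw [h, Γ'.flip_flip, ← hφ.2, casimirMatrix_symm]
    rfl

/-- The graphical calculus is invariant under isomorphisms of ribbon graphs. -/
lemma graphZ_eq_of_isIso {ι R H H' : Type*} [Fintype ι] [DecidableEq ι] [CommRing R]
    [Algebra ℂ R] [Fintype H] [DecidableEq H] [Fintype H'] [DecidableEq H']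
    (A : CyclicAlgebra V) (b : Module.Basis ι ℝ V) (x : ℕ+ → R)
    {Γ : RibbonGraph H} {Γ' : RibbonGraph H'} {φ : H ≃ H'} (hφ : Γ.IsIso Γ' φ) :
    A.graphZ b x Γ = A.graphZ b x Γ' := by
  unfold graphZ
  refine (Fintype.sum_equiv (φ.arrowCongr (Equiv.refl ι)).symm _ _ fun c => ?_).symm
  have hc : (φ.arrowCongr (Equiv.refl ι)).symm c = c ∘ φ := rfl
  rw [hc]
  congr 1
  · refine (Fintype.prod_equiv hφ.edgeEquiv _ _ fun e => ?_).symm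
    rw [edgeFactor_iso]
  · refine (Fintype.prod_equiv hφ.vertexEquiv _ _ fun v => ?_).symm
    rw [vertexFactor_iso, hφ.valence_eq]

end CyclicAlgebra

/-- `Z_x(Γ)` for an isomorphism class `Γ` of ribbon graphs. -/
def RibbonClass.graphZ {V : Type*} [NormedAddCommGroup V] [InnerProductSpace ℝ V]
    {ι : Type*} [Fintype ι] [DecidableEq ι] {R : Type*} [CommRing R] [Algebra ℂ R]
    (A : CyclicAlgebra V) (b : Module.Basis ι ℝ V) (x : ℕ+ → R) (Γ : RibbonClass) : R :=
  Quotient.lift (s := RibbonGraph.isoSetoid) (fun Γ : RibbonGraph.Labelled => A.graphZ b x Γ.2)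
    (fun _ _ h => h.elim fun _ hφ => A.graphZ_eq_of_isIso b x hφ) Γ

/-! ## The partition function -/

/-- The formal linear combination `∑ a k X_k` of the variables `X_1, X_2, …`. -/
def linearSeries (a : ℕ+ → ℂ) : MvPowerSeries ℕ+ ℂ :=
  fun m => if m.degree = 1 then m.sum fun k e => (e : ℂ) * a k else 0

namespace CyclicAlgebra

variable {V : Type*} [NormedAddCommGroup V] [InnerProductSpace ℝ V]

/-- The formal power series `exp (∑ X_k T k (v^{⊗ k}) / k)` in the variables `X_1, X_2, …`. -/
def expSeries (A : CyclicAlgebra V) (v : V) : MvPowerSeries ℕ+ ℂ :=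
  (PowerSeries.exp ℂ).subst (linearSeries fun k => A.diag k v / (k : ℂ))

/-- The partition function `∫ exp (∑ X_k T k (v^{⊗ k}) / k) dμ(v)` as a formal power series in
`X_1, X_2, …`: the integral of the formal series `expSeries`, coefficient by coefficient. -/
def partitionSeries [FiniteDimensional ℝ V] [MeasurableSpace V] [BorelSpace V]
    (A : CyclicAlgebra V) : MvPowerSeries ℕ+ ℂ :=
  fun m => ∫ v, MvPowerSeries.coeff m (A.expSeries v) ∂gaussianMeasure V

/-- The exponent `∑ x_k T k (v^{⊗ k}) / k` for complex numbers `x_1, x_2, …`. -/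
def potential (A : CyclicAlgebra V) (x : ℕ+ → ℂ) (v : V) : ℂ :=
  ∑' k : ℕ+, x k * A.diag k v / (k : ℂ)

end CyclicAlgebra

end

/-! By Wick's theorem (`integral_prod_inner`) a Gaussian moment of a product of linear functions is
the sum, over all pairings of the factors, of the products of covariances. Expand `T k (v^{⊗ k})` in
coordinates, whose covariance matrix is the Casimir matrix (`exists_dual_basis`). The integral of a
monomial ∏ T_k(v^{⊗ k})^{m_k} then becomes a sum over all ways to join in pairs the half-edges of a
set of vertices, m_k of them of valence k. Each pairing makes a ribbon graph, and its term is the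
graphical value (`sum_graphZ_of_rot_eq`).

The symmetry factors come from labelling the N = ∑ k m_k half-edges. There are N! / ∏ k^{m_k} m_k!
permutations with m_k cycles of length k (`card_cycleProfile_mul`), so the sum over labelled graphs
is N! times the integral of ∏ (T_k/k)^{m_k} / m_k!, a coefficient of the exponential series. An
isomorphism class has N! / |Aut| labellings (`card_isomorphic_mul_card_aut`). Comparing the two
counts gives `sum_withProfile_graphZ_div`, which is the formal identity.

For the actual integral, the graphs with at most n vertices add up to the integral of the degree n
Taylor polynomial of the exponential (`sum_boundedBy_graphZ_div`). The remainder at z is at most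
|z|^{n+1} max(1, e^{Re z}) (`norm_exp_sub_sum_le_pow_mul`). Here |z| is at most ∑ |x_k| times a
function of v of polynomial growth, and the bound on Re z with r < 1 keeps everything integrable,
uniformly in x. -/

noncomputable section

/-! ## Functions of polynomial growth and the Gaussian measure -/

/-- Continuous functions of at most polynomial growth. -/
def PolyGrowth {V F : Type*} [NormedAddCommGroup V] [NormedAddCommGroup F] (f : V → F) : Prop :=
  Continuous f ∧ ∃ (C : ℝ) (N : ℕ), ∀ v, ‖f v‖ ≤ C * (1 + ‖v‖) ^ N

namespace PolyGrowth

variable {V F : Type*} [NormedAddCommGroup V]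

lemma exists_nonneg [NormedAddCommGroup F] {f : V → F} (hf : PolyGrowth f) :
    ∃ (C : ℝ) (N : ℕ), 0 ≤ C ∧ ∀ v, ‖f v‖ ≤ C * (1 + ‖v‖) ^ N := by
  obtain ⟨-, C, N, h⟩ := hf
  refine ⟨C, N, ?_, h⟩
  have h0 := (norm_nonneg _).trans (h 0)
  simpa using h0

lemma const [NormedAddCommGroup F] (c : F) : PolyGrowth (fun _ : V => c) :=
  ⟨continuous_const, ‖c‖, 0, fun v => by simp⟩

lemma add [NormedAddCommGroup F] {f g : V → F} (hf : PolyGrowth f) (hg : PolyGrowth g) :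
    PolyGrowth (fun v => f v + g v) := by
  obtain ⟨C, N, hC, h⟩ := hf.exists_nonneg
  obtain ⟨D, M, hD, k⟩ := hg.exists_nonneg
  refine ⟨hf.1.add hg.1, C + D, N + M, fun v => ?_⟩
  have h1 : (1 : ℝ) ≤ 1 + ‖v‖ := by linarith [norm_nonneg v]
  have hN : (1 + ‖v‖) ^ N ≤ (1 + ‖v‖) ^ (N + M) := pow_le_pow_right₀ h1 (by omega)
  have hM : (1 + ‖v‖) ^ M ≤ (1 + ‖v‖) ^ (N + M) := pow_le_pow_right₀ h1 (by omega)
  calc ‖f v + g v‖ ≤ ‖f v‖ + ‖g v‖ := norm_add_le _ _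
    _ ≤ C * (1 + ‖v‖) ^ N + D * (1 + ‖v‖) ^ M := add_le_add (h v) (k v)
    _ ≤ C * (1 + ‖v‖) ^ (N + M) + D * (1 + ‖v‖) ^ (N + M) := by gcongr
    _ = _ := by ring

lemma sum [NormedAddCommGroup F] {α : Type*} (s : Finset α) {f : α → V → F}
    (hf : ∀ a ∈ s, PolyGrowth (f a)) : PolyGrowth (fun v => ∑ a ∈ s, f a v) := by
  classical
  induction s using Finset.induction_on with
  | empty => simpa using const (V := V) (0 : F)
  | insert a s ha ih =>
    simp only [Finset.sum_insert ha]
    exact (hf a (by simp)).add (ih fun b hb => hf b (by simp [hb]))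

lemma mul [NormedCommRing F] {f g : V → F} (hf : PolyGrowth f) (hg : PolyGrowth g) :
    PolyGrowth (fun v => f v * g v) := by
  obtain ⟨C, N, hC, h⟩ := hf.exists_nonneg
  obtain ⟨D, M, hD, k⟩ := hg.exists_nonneg
  refine ⟨hf.1.mul hg.1, C * D, N + M, fun v => ?_⟩
  calc ‖f v * g v‖ ≤ ‖f v‖ * ‖g v‖ := norm_mul_le _ _
    _ ≤ (C * (1 + ‖v‖) ^ N) * (D * (1 + ‖v‖) ^ M) :=
        mul_le_mul (h v) (k v) (norm_nonneg _) (by positivity)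
    _ = _ := by ring

lemma prod [NormedCommRing F] {α : Type*} (s : Finset α) {f : α → V → F}
    (hf : ∀ a ∈ s, PolyGrowth (f a)) : PolyGrowth (fun v => ∏ a ∈ s, f a v) := by
  classical
  induction s using Finset.induction_on with
  | empty => simpa using const (V := V) (1 : F)
  | insert a s ha ih =>
    simp only [Finset.prod_insert ha]
    exact (hf a (by simp)).mul (ih fun b hb => hf b (by simp [hb]))

lemma pow [NormedCommRing F] {f : V → F} (hf : PolyGrowth f) (n : ℕ) :
    PolyGrowth (fun v => f v ^ n) := by
  simpa using prod (Finset.range n) (f := fun _ => f) fun _ _ => hf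

lemma norm [NormedAddCommGroup F] {f : V → F} (hf : PolyGrowth f) :
    PolyGrowth (fun v => ‖f v‖) :=
  ⟨hf.1.norm, by simpa using hf.2⟩

lemma ofReal {f : V → ℝ} (hf : PolyGrowth f) : PolyGrowth (fun v => (f v : ℂ)) :=
  ⟨Complex.continuous_ofReal.comp hf.1, by simpa using hf.2⟩

lemma clm [NormedSpace ℝ V] (L : V →L[ℝ] ℝ) : PolyGrowth (fun v => L v) := by
  refine ⟨L.continuous, ‖L‖, 1, fun v => (L.le_opNorm v).trans ?_⟩
  rw [pow_one]
  gcongr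
  linarith

end PolyGrowth

section GaussianWeight

variable {V : Type*} [NormedAddCommGroup V] [InnerProductSpace ℝ V]

/-- The unnormalized Gaussian density `exp (-⟨v,v⟩/2)`. -/
def gaussianWeight (v : V) : ℝ := Real.exp (-(inner ℝ v v) / 2)

lemma gaussianWeight_eq (v : V) : gaussianWeight v = Real.exp (-(1 / 2) * ‖v‖ ^ 2) := by
  rw [gaussianWeight, real_inner_self_eq_norm_sq]
  ring_nf

lemma gaussianWeight_pos (v : V) : 0 < gaussianWeight v := Real.exp_pos _

lemma continuous_gaussianWeight : Continuous (gaussianWeight (V := V)) := by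
  unfold gaussianWeight
  fun_prop

lemma PolyGrowth.inner_left (u : V) : PolyGrowth (fun v : V => inner ℝ u v) :=
  PolyGrowth.clm (innerSL ℝ u)

/-- The logarithmic derivative of the weight is minus the inner product with `v`; this turns a
linear factor into a directional derivative in `integral_inner_mul_prod_inner`. -/
lemma hasFDerivAt_gaussianWeight (v : V) :
    HasFDerivAt (gaussianWeight (V := V)) (-(gaussianWeight v) • innerSL ℝ v) v := by
  have h := ((hasStrictFDerivAt_norm_sq v).hasFDerivAt.const_mul (-(1 / 2) : ℝ)).exp
  rw [← gaussianWeight_eq] at h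
  rw [show (gaussianWeight (V := V)) = fun w => Real.exp (-(1 / 2) * ‖w‖ ^ 2) from
    funext gaussianWeight_eq]
  refine h.congr_fderiv ?_
  ext w
  simp [gaussianWeight_eq]

end GaussianWeight

section Gaussian

variable {V : Type*} [NormedAddCommGroup V] [InnerProductSpace ℝ V]
  [FiniteDimensional ℝ V] [MeasurableSpace V] [BorelSpace V]

lemma integrable_exp_neg_mul_sq_norm {b : ℝ} (hb : 0 < b) :
    Integrable (fun v : V => Real.exp (-b * ‖v‖ ^ 2)) := by
  have h := (GaussianFourier.integrable_cexp_neg_mul_sq_norm_add (V := V) (b := (b : ℂ))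
    (by simpa using hb) 0 0).norm
  refine h.congr (Filter.Eventually.of_forall fun v => ?_)
  simp only [Complex.norm_exp]
  congr 1
  simp [← Complex.ofReal_pow]

lemma PolyGrowth.integrable_exp_smul {F : Type*} [NormedAddCommGroup F] [NormedSpace ℝ F]
    {f : V → F} (hf : PolyGrowth f) {b : ℝ} (hb : 0 < b) :
    Integrable (fun v : V => Real.exp (-b * ‖v‖ ^ 2) • f v) := by
  obtain ⟨C, N, hC, h⟩ := hf.exists_nonneg
  -- Half of the exponent is kept for integrability. The other half absorbs the polynomial, through
  -- (1+t)^N ≤ N! e^{1+t} and t ≤ b t²/2 + 1/(2b).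
  have hI := (integrable_exp_neg_mul_sq_norm (V := V) (half_pos hb)).const_mul
    (C * (N.factorial * Real.exp (1 + 1 / (2 * b))))
  refine hI.mono' ?_ (Filter.Eventually.of_forall fun v => ?_)
  · refine Continuous.aestronglyMeasurable ?_
    have := hf.1
    fun_prop
  · have h0 : 0 ≤ 1 + ‖v‖ := by positivity
    have h1 : (1 + ‖v‖) ^ N ≤ N.factorial * Real.exp (1 + ‖v‖) := by
      have := Real.pow_div_factorial_le_exp (1 + ‖v‖) h0 N
      rw [div_le_iff₀ (by positivity)] at this
      linarith
    have h2 : 1 + ‖v‖ + -b * ‖v‖ ^ 2 ≤ 1 + 1 / (2 * b) + -(b / 2) * ‖v‖ ^ 2 := by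
      have h3 : 0 ≤ (b / 2) * (‖v‖ - 1 / b) ^ 2 := by positivity
      have h4 : (b / 2) * (‖v‖ - 1 / b) ^ 2 = b / 2 * ‖v‖ ^ 2 - ‖v‖ + 1 / (2 * b) := by
        field_simp
        ring
      linarith
    rw [norm_smul, Real.norm_of_nonneg (Real.exp_pos _).le]
    calc Real.exp (-b * ‖v‖ ^ 2) * ‖f v‖
        ≤ Real.exp (-b * ‖v‖ ^ 2) * (C * (N.factorial * Real.exp (1 + ‖v‖))) := by
          gcongr
          exact (h v).trans (by gcongr)
      _ = C * N.factorial * Real.exp (1 + ‖v‖ + -b * ‖v‖ ^ 2) := by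
          rw [Real.exp_add (1 + ‖v‖)]
          ring
      _ ≤ C * N.factorial * Real.exp (1 + 1 / (2 * b) + -(b / 2) * ‖v‖ ^ 2) := by gcongr
      _ = _ := by
          rw [Real.exp_add]
          ring

lemma integrable_gaussianWeight : Integrable (gaussianWeight (V := V)) := by
  simpa only [← gaussianWeight_eq] using
    integrable_exp_neg_mul_sq_norm (V := V) (b := 1 / 2) (by norm_num)

lemma lintegral_gaussianWeight_ne_top :
    ∫⁻ v : V, ENNReal.ofReal (gaussianWeight v) ≠ ⊤ :=
  integrable_gaussianWeight.lintegral_lt_top.ne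

lemma lintegral_gaussianWeight_ne_zero :
    ∫⁻ v : V, ENNReal.ofReal (gaussianWeight v) ≠ 0 := by
  have hm : Measurable fun v : V => ENNReal.ofReal (gaussianWeight v) :=
    (continuous_gaussianWeight.measurable).ennreal_ofReal
  rw [Ne, lintegral_eq_zero_iff hm]
  intro h
  have h' : ∀ᵐ v : V, False := by
    filter_upwards [h] with v hv
    have := gaussianWeight_pos v
    simp only [Pi.zero_apply, ENNReal.ofReal_eq_zero] at hv
    linarith
  have h0 : (volume : Measure V) = 0 := by simpa using h'
  exact NeZero.ne (volume : Measure V) h0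

lemma gaussianMeasure_eq : gaussianMeasure V =
    (∫⁻ v : V, ENNReal.ofReal (gaussianWeight v))⁻¹ •
      (volume : Measure V).withDensity (fun v => ENNReal.ofReal (gaussianWeight v)) := rfl

instance : IsProbabilityMeasure (gaussianMeasure V) := by
  constructor
  rw [gaussianMeasure_eq, Measure.smul_apply, withDensity_apply _ MeasurableSet.univ,
    Measure.restrict_univ, smul_eq_mul]
  exact ENNReal.inv_mul_cancel lintegral_gaussianWeight_ne_zero lintegral_gaussianWeight_ne_top

lemma integrable_gaussianMeasure_iff {F : Type*} [NormedAddCommGroup F] [NormedSpace ℝ F]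
    {f : V → F} :
    Integrable f (gaussianMeasure V) ↔ Integrable (fun v => gaussianWeight v • f v) := by
  rw [gaussianMeasure_eq, integrable_smul_measure
    (ENNReal.inv_ne_zero.2 lintegral_gaussianWeight_ne_top)
    (ENNReal.inv_ne_top.2 lintegral_gaussianWeight_ne_zero)]
  rw [integrable_withDensity_iff_integrable_smul₀'
    (continuous_gaussianWeight.measurable.ennreal_ofReal.aemeasurable)
    (Filter.Eventually.of_forall fun v => ENNReal.ofReal_lt_top)]
  simp only [ENNReal.toReal_ofReal (gaussianWeight_pos _).le]

lemma integral_gaussianMeasure {F : Type*} [NormedAddCommGroup F] [NormedSpace ℝ F]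
    (f : V → F) :
    ∫ v, f v ∂gaussianMeasure V =
      (∫⁻ v : V, ENNReal.ofReal (gaussianWeight v))⁻¹.toReal • ∫ v, gaussianWeight v • f v := by
  rw [gaussianMeasure_eq, integral_smul_measure, integral_withDensity_eq_integral_toReal_smul
    (continuous_gaussianWeight.measurable.ennreal_ofReal)
    (Filter.Eventually.of_forall fun v => ENNReal.ofReal_lt_top)]
  simp only [ENNReal.toReal_ofReal (gaussianWeight_pos _).le]

/-- Together with the Gaussian weight the exponent is −(1−r)/2 · ‖v‖², still negative definite
because r < 1. -/
lemma PolyGrowth.integrable_exp_mul {f : V → ℝ} (hf : PolyGrowth f) {r : ℝ} (hr : r < 1) :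
    Integrable (fun v => Real.exp (r * (inner ℝ v v / 2)) * f v) (gaussianMeasure V) := by
  rw [integrable_gaussianMeasure_iff]
  refine (hf.integrable_exp_smul (b := (1 - r) / 2) (by linarith)).congr
    (Filter.Eventually.of_forall fun v => ?_)
  simp only [smul_eq_mul, gaussianWeight_eq, real_inner_self_eq_norm_sq, ← mul_assoc,
    ← Real.exp_add]
  ring_nf

lemma PolyGrowth.integrable {F : Type*} [NormedAddCommGroup F] [NormedSpace ℝ F]
    {f : V → F} (hf : PolyGrowth f) : Integrable f (gaussianMeasure V) := by
  rw [integrable_gaussianMeasure_iff]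
  simpa only [gaussianWeight_eq] using hf.integrable_exp_smul (b := 1 / 2) (by norm_num)

/-- Integration by parts against the Gaussian measure, for products of linear functions. -/
lemma integral_inner_mul_prod_inner {H : Type*} [DecidableEq H] (u : H → V) (a : V)
    (S : Finset H) :
    ∫ v, inner ℝ a v * ∏ h ∈ S, inner ℝ (u h) v ∂gaussianMeasure V =
      ∑ h ∈ S, inner ℝ a (u h) * ∫ v, ∏ k ∈ S.erase h, inner ℝ (u k) v ∂gaussianMeasure V := by
  have hP : PolyGrowth fun v : V => ∏ h ∈ S, inner ℝ (u h) v :=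
    PolyGrowth.prod _ fun h _ => PolyGrowth.inner_left (u h)
  have hS : ∀ h, PolyGrowth fun v : V => inner ℝ a (u h) * ∏ k ∈ S.erase h, inner ℝ (u k) v :=
    fun h => (PolyGrowth.const _).mul (PolyGrowth.prod _ fun h _ => PolyGrowth.inner_left (u h))
  simp_rw [← integral_const_mul]
  rw [← integral_finsetSum _ fun h _ => (hS h).integrable, integral_gaussianMeasure,
    integral_gaussianMeasure]
  congr 1
  -- Differentiate in the direction `a`: the weight yields the factor −⟨a, v⟩, and the Leibniz rule
  -- removes one factor from the product at a time. Integrability takes care of the boundary terms.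
  have key := integral_bilinear_hasFDerivAt_right_eq_neg_left_of_integrable
    (μ := (volume : Measure V)) (B := ContinuousLinearMap.mul ℝ ℝ) (v := a)
    (f := fun v : V => ∏ h ∈ S, inner ℝ (u h) v)
    (f' := fun v => ∑ h ∈ S, (∏ k ∈ S.erase h, inner ℝ (u k) v) • innerSL ℝ (u h))
    (g := gaussianWeight) (g' := fun v => -(gaussianWeight v) • innerSL ℝ v) ?_ ?_ ?_ ?_ ?_
  · simp only [ContinuousLinearMap.mul_apply', smul_eq_mul, smul_apply,
      innerSL_apply_apply, sum_apply] at key ⊢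
    rw [← neg_inj, ← integral_neg]
    refine (Eq.trans ?_ key).trans (congrArg Neg.neg ?_)
    · refine integral_congr_ae (Filter.Eventually.of_forall fun v => ?_)
      simp only [real_inner_comm v a]
      ring
    · refine integral_congr_ae (Filter.Eventually.of_forall fun v => ?_)
      simp only
      rw [mul_comm]
      congr 1
      refine Finset.sum_congr rfl fun h _ => ?_
      rw [mul_comm, real_inner_comm]
  · have := integrable_gaussianMeasure_iff.1
      (PolyGrowth.sum S (f := fun h v => inner ℝ a (u h) * ∏ k ∈ S.erase h, inner ℝ (u k) v)
        fun h _ => hS h).integrable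
    refine this.congr (Filter.Eventually.of_forall fun v => ?_)
    simp only [ContinuousLinearMap.mul_apply', smul_eq_mul, smul_apply,
      innerSL_apply_apply, sum_apply]
    rw [mul_comm]
    congr 1
    refine Finset.sum_congr rfl fun h _ => ?_
    rw [mul_comm, real_inner_comm]
  · have := (integrable_gaussianMeasure_iff.1 ((PolyGrowth.inner_left a).mul hP).integrable).neg
    refine this.congr (Filter.Eventually.of_forall fun v => ?_)
    simp only [ContinuousLinearMap.mul_apply', smul_eq_mul, smul_apply,
      innerSL_apply_apply, Pi.neg_apply]
    rw [real_inner_comm]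
    ring
  · refine (integrable_gaussianMeasure_iff.1 hP.integrable).congr
      (Filter.Eventually.of_forall fun v => ?_)
    simp only [ContinuousLinearMap.mul_apply', smul_eq_mul]
    rw [mul_comm]
  · intro v _
    exact HasFDerivAt.finsetProd fun h _ => (innerSL ℝ (u h)).hasFDerivAt
  · intro v _
    exact hasFDerivAt_gaussianWeight v

end Gaussian

/-! ## Wick's theorem -/

/-- The involutions whose set of moved points is `S`. -/
def pairings {H : Type*} [Fintype H] [DecidableEq H] (S : Finset H) : Finset (Equiv.Perm H) :=
  Finset.univ.filter fun f => (∀ h, f (f h) = h) ∧ ∀ h, f h ≠ h ↔ h ∈ S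

section Pairings

lemma mul_swap_apply_of_ne {H : Type*} [DecidableEq H] {f : Equiv.Perm H} {a k h : H}
    (h1 : h ≠ a) (h2 : h ≠ k) : (f * Equiv.swap a k) h = f h := by
  rw [Equiv.Perm.mul_apply, Equiv.swap_apply_of_ne_of_ne h1 h2]

variable {H : Type*} [Fintype H] [DecidableEq H]

lemma mem_pairings {S : Finset H} {f : Equiv.Perm H} :
    f ∈ pairings S ↔ (∀ h, f (f h) = h) ∧ ∀ h, f h ≠ h ↔ h ∈ S := by
  simp [pairings]

lemma pairings_empty : pairings (∅ : Finset H) = {1} := by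
  ext f
  simp only [mem_pairings, Finset.notMem_empty, iff_false, not_not, Finset.mem_singleton]
  exact ⟨fun h => Equiv.ext h.2, fun h => by simp [h]⟩

/-- `f` fixes `a` and `k`, so the transposition only joins these two. With
`mul_swap_apply_mem_pairings`, its inverse, this is the recursion for pairings: choose a partner for
`a`, then pair the rest. -/
lemma mul_swap_mem_pairings {S : Finset H} {a k : H} (ha : a ∈ S) (hk : k ∈ S.erase a)
    {f : Equiv.Perm H} (hf : f ∈ pairings ((S.erase a).erase k)) :
    f * Equiv.swap a k ∈ pairings S := by
  rw [mem_pairings] at hf ⊢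
  obtain ⟨hka, hkS⟩ := Finset.mem_erase.1 hk
  have hfa : f a = a := by
    by_contra h
    simpa using (hf.2 a).1 h
  have hfk : f k = k := by
    by_contra h
    simpa using (hf.2 k).1 h
  have h1 : (f * Equiv.swap a k) a = k := by simp [hfk]
  have h2 : (f * Equiv.swap a k) k = a := by simp [hfa]
  have hne : ∀ h, h ≠ a → h ≠ k → f h ≠ a ∧ f h ≠ k := fun h ha' hk' =>
    ⟨fun e => ha' (f.injective (e.trans hfa.symm)), fun e => hk' (f.injective (e.trans hfk.symm))⟩
  constructor
  · intro h
    by_cases e1 : h = a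
    · rw [e1, h1, h2]
    by_cases e2 : h = k
    · rw [e2, h2, h1]
    rw [mul_swap_apply_of_ne e1 e2, mul_swap_apply_of_ne (hne h e1 e2).1 (hne h e1 e2).2, hf.1]
  · intro h
    by_cases e1 : h = a
    · rw [e1, h1]
      exact ⟨fun _ => ha, fun _ => hka⟩
    by_cases e2 : h = k
    · rw [e2, h2]
      exact ⟨fun _ => hkS, fun _ => hka.symm⟩
    rw [mul_swap_apply_of_ne e1 e2, hf.2]
    simp [e1, e2]

lemma mul_swap_apply_mem_pairings {S : Finset H} {a : H} (ha : a ∈ S)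
    {f : Equiv.Perm H} (hf : f ∈ pairings S) :
    f a ∈ S.erase a ∧ f * Equiv.swap a (f a) ∈ pairings ((S.erase a).erase (f a)) := by
  rw [mem_pairings] at hf ⊢
  have hne : f a ≠ a := (hf.2 a).2 ha
  have hS : f a ∈ S := (hf.2 _).1 fun h => hne (f.injective h)
  refine ⟨Finset.mem_erase.2 ⟨hne, hS⟩, fun h => ?_, fun h => ?_⟩
  · by_cases e1 : h = a
    · subst e1
      simp [hf.1]
    by_cases e2 : h = f a
    · subst e2
      simp
    have e3 : f h ≠ a := fun e => e2 (by rw [← e, hf.1])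
    have e4 : f h ≠ f a := fun e => e1 (f.injective e)
    rw [mul_swap_apply_of_ne e1 e2, mul_swap_apply_of_ne e3 e4, hf.1]
  · by_cases e1 : h = a
    · subst e1
      simp [hf.1]
    by_cases e2 : h = f a
    · subst e2
      simp
    rw [mul_swap_apply_of_ne e1 e2, hf.2]
    simp [e1, e2]

end Pairings

section Wick

variable {V : Type*} [NormedAddCommGroup V] [InnerProductSpace ℝ V]
  [FiniteDimensional ℝ V] [MeasurableSpace V] [BorelSpace V]

/-- **Wick's theorem**. -/
theorem integral_prod_inner {H : Type*} [Fintype H] [LinearOrder H] (u : H → V)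
    (S : Finset H) :
    ∫ v, ∏ h ∈ S, inner ℝ (u h) v ∂gaussianMeasure V =
      ∑ f ∈ pairings S, ∏ h ∈ S with h < f h, inner ℝ (u h) (u (f h)) := by
  induction S using Finset.strongInduction with
  | H S ih =>
  rcases S.eq_empty_or_nonempty with rfl | hS
  · simp [pairings_empty]
  -- Minimality makes `a` the smaller half of its pair in every pairing, so the filter `h < f h`
  -- records this pair at `a` and never at the partner.
  obtain ⟨a, ha⟩ : ∃ a, a = S.min' hS := ⟨_, rfl⟩
  have haS : a ∈ S := ha ▸ S.min'_mem hS
  have hmin : ∀ h ∈ S, a ≤ h := fun h hh => ha ▸ S.min'_le h hh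
  simp_rw [← Finset.mul_prod_erase S _ haS]
  rw [integral_inner_mul_prod_inner]
  have hsub : ∀ k ∈ S.erase a, (S.erase a).erase k ⊂ S := fun k hk =>
    (Finset.erase_ssubset hk).trans (Finset.erase_ssubset haS)
  rw [Finset.sum_congr rfl fun k hk => by rw [ih _ (hsub k hk), Finset.mul_sum],
    Finset.sum_sigma']
  refine Finset.sum_bij' (fun p _ => p.2 * Equiv.swap a p.1)
    (fun f _ => ⟨f a, f * Equiv.swap a (f a)⟩) ?_ ?_ ?_ ?_ ?_
  · rintro ⟨k, f⟩ hp
    rw [Finset.mem_sigma] at hp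
    exact mul_swap_mem_pairings haS hp.1 hp.2
  · intro f hf
    rw [Finset.mem_sigma]
    exact mul_swap_apply_mem_pairings haS hf
  · rintro ⟨k, f⟩ hp
    rw [Finset.mem_sigma] at hp
    obtain ⟨-, hf⟩ := hp
    have hfk : f k = k := by
      by_contra h
      simpa using ((mem_pairings.1 hf).2 k).1 h
    simp [hfk, mul_assoc]
  · intro f hf
    simp [mul_assoc]
  · rintro ⟨k, f⟩ hp
    rw [Finset.mem_sigma] at hp
    obtain ⟨hk, hf⟩ := hp
    simp only at hk hf ⊢
    obtain ⟨hka, hkS⟩ := Finset.mem_erase.1 hk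
    have hfa : f a = a := by
      by_contra h
      simpa using ((mem_pairings.1 hf).2 a).1 h
    have hfk : f k = k := by
      by_contra h
      simpa using ((mem_pairings.1 hf).2 k).1 h
    have h1 : (f * Equiv.swap a k) a = k := by simp [hfk]
    have h2 : (f * Equiv.swap a k) k = a := by simp [hfa]
    have hfil : (S.filter fun h => h < (f * Equiv.swap a k) h) =
        insert a (((S.erase a).erase k).filter fun h => h < f h) := by
      ext h
      simp only [Finset.mem_filter, Finset.mem_insert, Finset.mem_erase]
      by_cases e1 : h = a
      · subst e1
        simp only [h1, haS, true_and, true_or, iff_true]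
        exact lt_of_le_of_ne (hmin k hkS) (Ne.symm hka)
      by_cases e2 : h = k
      · subst e2
        simp only [h2, e1, false_or, ne_eq, not_true, false_and, iff_false, not_and, not_lt]
        exact hmin h
      rw [mul_swap_apply_of_ne e1 e2]
      simp [e1, e2]
    rw [hfil, Finset.prod_insert (by simp), h1]
    congr 1
    refine Finset.prod_congr rfl fun h hh => ?_
    simp only [Finset.mem_filter, Finset.mem_erase] at hh
    rw [mul_swap_apply_of_ne hh.1.2.1 hh.1.1]

end Wick

/-! ## The remainder of the exponential series -/

/-- The derivative in t of the remainder of order n+1 at tz is z times the remainder of order n at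
tz, so the bound follows by induction and the mean value inequality on [0,1]. Having Re z instead of
|z| in the exponent is essential: only the real part of the potential is controlled. -/
lemma norm_exp_sub_sum_le_pow_mul (n : ℕ) (z : ℂ) :
    ‖Complex.exp z - ∑ j ∈ Finset.range n, z ^ j / (j.factorial : ℂ)‖ ≤
      ‖z‖ ^ n * max 1 (Real.exp z.re) := by
  induction n generalizing z with
  | zero => simp [Complex.norm_exp]
  | succ n ih =>
    have hd : ∀ t : ℝ, HasDerivAt
        (fun t : ℝ => Complex.exp (t * z) -
          ∑ j ∈ Finset.range (n + 1), ((t : ℂ) * z) ^ j / (j.factorial : ℂ))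
        (z * (Complex.exp (t * z) -
          ∑ j ∈ Finset.range n, ((t : ℂ) * z) ^ j / (j.factorial : ℂ))) t := by
      intro t
      have h1 : HasDerivAt (fun t : ℝ => (t : ℂ) * z) z t := by
        simpa using (Complex.ofRealCLM.hasDerivAt (x := t)).mul_const z
      have h2 := h1.cexp
      have h3 := h2.sub (HasDerivAt.fun_sum (u := Finset.range (n + 1))
        fun j _ => (h1.pow j).div_const (j.factorial : ℂ))
      refine h3.congr_deriv ?_
      rw [Finset.sum_range_succ', mul_sub, mul_comm z, Finset.mul_sum]
      simp only [Nat.cast_zero, zero_mul, zero_div, add_zero]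
      congr 1
      refine Finset.sum_congr rfl fun j _ => ?_
      rw [Nat.factorial_succ, Nat.add_sub_cancel]
      push_cast
      have : (j : ℂ) + 1 ≠ 0 := by exact_mod_cast j.succ_ne_zero
      have : (j.factorial : ℂ) ≠ 0 := by exact_mod_cast j.factorial_ne_zero
      field_simp
    have hb := norm_image_sub_le_of_norm_deriv_le_segment_01'
      (C := ‖z‖ ^ (n + 1) * max 1 (Real.exp z.re))
      (fun t _ => (hd t).hasDerivWithinAt) (fun t ht => by
        rw [norm_mul, pow_succ', mul_assoc]
        refine mul_le_mul_of_nonneg_left ((ih _).trans ?_) (norm_nonneg _)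
        have ht0 : 0 ≤ t := ht.1
        have ht1 : t ≤ 1 := ht.2.le
        have hn : ‖(t : ℂ) * z‖ ≤ ‖z‖ := by
          rw [norm_mul, Complex.norm_real, Real.norm_of_nonneg ht0]
          exact mul_le_of_le_one_left (norm_nonneg _) ht1
        have hre : ((t : ℂ) * z).re = t * z.re := by simp
        refine mul_le_mul (pow_le_pow_left₀ (norm_nonneg _) hn n) ?_ (by positivity)
          (by positivity)
        rw [hre]
        -- e^{t Re z} lies between 1 and e^{Re z}, whatever the sign of Re z.
        refine max_le (le_max_left _ _) ?_
        rcases le_total 0 z.re with h | h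
        · exact (Real.exp_le_exp.2 (mul_le_of_le_one_left h ht1)).trans (le_max_right _ _)
        · refine le_trans ?_ (le_max_left _ _)
          rw [Real.exp_le_one_iff]
          exact mul_nonpos_of_nonneg_of_nonpos ht0 h)
    -- The remainder vanishes at t = 0: only `j = 0` survives, with `0 ^ 0 = 1`.
    have h0 : ∑ j ∈ Finset.range (n + 1), ((0 : ℂ)) ^ j / (j.factorial : ℂ) = 1 := by
      rw [Finset.sum_range_succ']
      simp
    simpa [h0] using hb

/-! ## Cycles of permutations, fixed points included -/

/-- The cycles of a permutation, fixed points included, as orbits of points. -/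
abbrev CycleOrbit {H : Type*} (σ : Equiv.Perm H) : Type _ :=
  Quotient (Equiv.Perm.SameCycle.setoid σ)

namespace CycleOrbit

section Defs

variable {H : Type*} (σ : Equiv.Perm H)

/-- The cycle through a point. -/
def mk (h : H) : CycleOrbit σ := Quotient.mk _ h

variable {σ}

lemma mk_eq_iff {h h' : H} : mk σ h = mk σ h' ↔ σ.SameCycle h h' := Quotient.eq

/-- A point of a cycle. -/
def base (q : CycleOrbit σ) : H := Quotient.out q

lemma mk_base (q : CycleOrbit σ) : mk σ q.base = q := Quotient.out_eq q

instance [Finite H] : Fintype (CycleOrbit σ) := Fintype.ofFinite _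

/-- The length of a cycle. -/
def length [Finite H] (q : CycleOrbit σ) : ℕ+ :=
  ⟨Nat.card {h : H // mk σ h = q},
    haveI : Nonempty {h : H // mk σ h = q} := ⟨⟨q.base, q.mk_base⟩⟩
    Nat.card_pos⟩

lemma length_eq_minimalPeriod [Finite H] (q : CycleOrbit σ) :
    (q.length : ℕ) = Function.minimalPeriod (σ • ·) q.base := by
  have : Fintype (MulAction.orbit (Subgroup.zpowers σ) q.base) := Fintype.ofFinite _
  rw [MulAction.minimalPeriod_eq_card, ← Nat.card_eq_fintype_card]
  refine Nat.card_congr (Equiv.subtypeEquivRight fun h' => ?_)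
  conv_lhs => rw [← q.mk_base]
  rw [mk_eq_iff, MulAction.mem_orbit_iff]
  constructor
  · intro hs
    obtain ⟨n, hn⟩ := hs.symm
    exact ⟨⟨σ ^ n, n, rfl⟩, hn⟩
  · rintro ⟨⟨_, n, rfl⟩, hn⟩
    exact Equiv.Perm.SameCycle.symm ⟨n, hn⟩

lemma mk_pow_apply (h : H) (n : ℕ) : mk σ ((σ ^ n) h) = mk σ h :=
  mk_eq_iff.2 (Equiv.Perm.SameCycle.symm ⟨n, by simp⟩)

/-- The points are enumerated by going around each of the cycles. -/
lemma bijective_enum [Finite H] (σ : Equiv.Perm H) :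
    Function.Bijective fun p : Σ q : CycleOrbit σ, Fin q.length =>
      (σ ^ (p.2 : ℕ)) p.1.base := by
  have hinj : Function.Injective fun p : Σ q : CycleOrbit σ, Fin q.length =>
      (σ ^ (p.2 : ℕ)) p.1.base := by
    rintro ⟨q, i⟩ ⟨q', j⟩ h
    simp only at h
    have hq : q = q' := by
      rw [← q.mk_base, ← q'.mk_base, ← mk_pow_apply _ (i : ℕ), ← mk_pow_apply q'.base (j : ℕ), h]
    subst hq
    congr 1
    have hi : ∀ i : Fin q.length, (i : ℕ) ∈ Set.Iio (Function.minimalPeriod (σ • ·) q.base) :=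
      fun i => by
        rw [← length_eq_minimalPeriod]
        exact i.2
    refine Fin.ext (Function.iterate_injOn_Iio_minimalPeriod (hi i) (hi j) ?_)
    rw [← Equiv.Perm.iterate_eq_pow, ← Equiv.Perm.iterate_eq_pow] at h
    exact h
  have := Fintype.ofFinite H
  -- Surjectivity follows by counting: the fibres of `mk σ` partition the points and their sizes are
  -- the lengths.
  rw [Fintype.bijective_iff_injective_and_card]
  refine ⟨hinj, ?_⟩
  classical
  rw [Fintype.card_sigma, ← Nat.card_eq_fintype_card (α := H),
    ← Nat.card_congr (Equiv.sigmaFiberEquiv (mk σ)), Nat.card_sigma]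
  refine Finset.sum_congr rfl fun q _ => ?_
  rw [Fintype.card_fin]
  rfl

/-- The bijection of `bijective_enum`. -/
def enumEquiv [Finite H] (σ : Equiv.Perm H) : (Σ q : CycleOrbit σ, Fin q.length) ≃ H :=
  Equiv.ofBijective _ (bijective_enum σ)

lemma sum_length [Fintype H] (σ : Equiv.Perm H) :
    ∑ q : CycleOrbit σ, (q.length : ℕ) = Fintype.card H := by
  rw [← Fintype.card_congr (enumEquiv σ), Fintype.card_sigma]
  simp

end Defs

end CycleOrbit

/-- The number of cycles of each length, fixed points being the cycles of length one. -/
def cycleProfile {H : Type*} [Finite H] (σ : Equiv.Perm H) : ℕ+ →₀ ℕ :=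
  ∑ q : CycleOrbit σ, Finsupp.single q.length 1

/-! ### Counting the permutations with prescribed numbers of cycles -/

section CycleProfile

variable {H : Type*}

lemma cycleProfile_apply [Finite H] (σ : Equiv.Perm H) (k : ℕ+) :
    cycleProfile σ k = (Finset.univ.filter fun q : CycleOrbit σ => q.length = k).card := by
  rw [cycleProfile, Finsupp.finsetSum_apply, Finset.card_filter]
  refine Finset.sum_congr rfl fun q _ => ?_
  rw [Finsupp.single_apply]

/-- Products over the cycles of functions of the length. -/
lemma prod_length_eq [Finite H] {M : Type*} [CommMonoid M] (σ : Equiv.Perm H) (f : ℕ+ → M) :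
    ∏ q : CycleOrbit σ, f q.length = (cycleProfile σ).prod fun k e => f k ^ e := by
  rw [cycleProfile, ← Finsupp.prod_finsetSum_index (by simp) (by simp [pow_add])]
  simp

/-- The profile thus determines the number of half-edges, which is why only finitely many graphs
share a profile. -/
lemma cycleProfile_sum [Fintype H] (σ : Equiv.Perm H) :
    ((cycleProfile σ).sum fun k e => e * (k : ℕ)) = Fintype.card H := by
  rw [← CycleOrbit.sum_length σ, cycleProfile,
    ← Finsupp.sum_finsetSum_index (by simp) (by simp [add_mul])]
  simp

/-- `cycleType` omits fixed points, which here are the univalent vertices; for longer cycles the two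
counts agree, each cycle orbit giving the cycle factor through its base point. -/
lemma count_cycleType [Fintype H] [DecidableEq H] (σ : Equiv.Perm H) (k : ℕ+) (hk : 1 < k) :
    σ.cycleType.count (k : ℕ) = cycleProfile σ k := by
  classical
  have hlen : ∀ q : CycleOrbit σ, q.base ∈ σ.support →
      (σ.cycleOf q.base).support.card = q.length := by
    intro q hq
    rw [CycleOrbit.length, PNat.mk_coe, Nat.card_eq_fintype_card, Fintype.card_subtype]
    congr 1
    ext y
    rw [Equiv.Perm.mem_support_cycleOf_iff' (Equiv.Perm.mem_support.1 hq)]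
    simp only [Finset.mem_filter, Finset.mem_univ, true_and]
    conv_rhs => rw [← q.mk_base]
    rw [CycleOrbit.mk_eq_iff, Equiv.Perm.sameCycle_comm]
  have hsupp : ∀ q : CycleOrbit σ, q.length = k → q.base ∈ σ.support := by
    intro q hq
    rw [Equiv.Perm.mem_support]
    intro hfix
    have h1 : (q.length : ℕ) = 1 := by
      rw [CycleOrbit.length_eq_minimalPeriod]
      exact Function.minimalPeriod_eq_one_iff_isFixedPt.2 hfix
    rw [hq] at h1
    have : (1 : ℕ) < k := hk
    omega
  rw [cycleProfile_apply, Equiv.Perm.cycleType_def, Multiset.count_map, ← Finset.filter_val,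
    Finset.card_val]
  refine (Finset.card_nbij (fun q => σ.cycleOf q.base) ?_ ?_ ?_).symm
  · intro q hq
    rw [Finset.mem_coe, Finset.mem_filter] at hq ⊢
    replace hq := hq.2
    refine ⟨Equiv.Perm.cycleOf_mem_cycleFactorsFinset_iff.2 (hsupp q hq), ?_⟩
    rw [Function.comp_apply, hlen q (hsupp q hq), hq]
  · intro q hq q' hq' h
    simp only [Finset.coe_filter, Finset.mem_univ, true_and, Set.mem_ofPred_eq] at hq hq' h
    rw [← q.mk_base, ← q'.mk_base, CycleOrbit.mk_eq_iff]
    exact (Equiv.Perm.sameCycle_iff_cycleOf_eq_of_mem_support (hsupp q hq) (hsupp q' hq')).2 h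
  · intro c hc
    simp only [Finset.coe_filter, Function.comp_apply, Set.mem_ofPred_eq] at hc
    obtain ⟨hc, hck⟩ := hc
    obtain ⟨a, ha⟩ : c.support.Nonempty := by
      rw [← Finset.card_pos, ← hck]
      exact k.pos
    have hca := Equiv.Perm.cycle_is_cycleOf ha hc
    have haσ : a ∈ σ.support := Equiv.Perm.mem_cycleFactorsFinset_support_le hc ha
    have hs : σ.SameCycle (CycleOrbit.mk σ a).base a := by
      rw [← CycleOrbit.mk_eq_iff, CycleOrbit.mk_base]
    have hco : σ.cycleOf (CycleOrbit.mk σ a).base = c := by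
      rw [hca]
      exact hs.cycleOf_eq
    have hbs : (CycleOrbit.mk σ a).base ∈ σ.support := by
      rw [← Equiv.Perm.cycleOf_mem_cycleFactorsFinset_iff, hco]
      exact hc
    refine ⟨CycleOrbit.mk σ a, ?_, hco⟩
    simp only [Finset.coe_filter, Finset.mem_univ, true_and, Set.mem_ofPred_eq]
    apply PNat.coe_injective
    rw [← hlen _ hbs, hco, hck]

/-- The multiset of numbers at least two with the multiplicities given by `m`. -/
def multisetOfProfile (m : ℕ+ →₀ ℕ) : Multiset ℕ :=
  Finsupp.toMultiset ((m.erase 1).embDomain ⟨PNat.val, PNat.coe_injective⟩)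

lemma count_multisetOfProfile (m : ℕ+ →₀ ℕ) (k : ℕ+) (hk : 1 < k) :
    (multisetOfProfile m).count (k : ℕ) = m k := by
  rw [multisetOfProfile, Finsupp.count_toMultiset]
  have := Finsupp.embDomain_apply_self ⟨PNat.val, PNat.coe_injective⟩ (m.erase 1) k
  rw [Finsupp.erase_ne hk.ne'] at this
  exact this

lemma two_le_of_mem_multisetOfProfile {m : ℕ+ →₀ ℕ} {n : ℕ} (hn : n ∈ multisetOfProfile m) :
    2 ≤ n := by
  rw [multisetOfProfile, Finsupp.mem_toMultiset, Finsupp.support_embDomain,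
    Finset.mem_map] at hn
  obtain ⟨k, hk, rfl⟩ := hn
  rw [Finsupp.support_erase, Finset.mem_erase] at hk
  have h1 : (k : ℕ) ≠ 1 := fun h => hk.1 (PNat.coe_injective h)
  have h2 := k.pos
  show 2 ≤ (k : ℕ)
  omega

/-- Splits off the fixed points, so that their number can be recovered from the total. -/
lemma sum_eq_add_erase (m : ℕ+ →₀ ℕ) :
    (m.sum fun k e => e * (k : ℕ)) = m 1 + (multisetOfProfile m).sum := by
  have h1 : (multisetOfProfile m).sum = (m.erase 1).sum fun k e => e * (k : ℕ) := by
    rw [multisetOfProfile, Finsupp.toMultiset_apply, Finsupp.sum_embDomain, Finsupp.sum,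
      Multiset.sum_sum, Finsupp.sum]
    refine Finset.sum_congr rfl fun k _ => ?_
    rw [Multiset.sum_nsmul, Multiset.sum_singleton, smul_eq_mul]
    rfl
  rw [h1, ← Finsupp.add_sum_erase' m 1 (fun k e => e * (k : ℕ)) (by simp)]
  simp

/-- The cycle type forgets the fixed points, but `hm` fixes the total and hence the value at 1. -/
lemma cycleType_eq_iff [Fintype H] [DecidableEq H] (σ : Equiv.Perm H) (m : ℕ+ →₀ ℕ)
    (hm : (m.sum fun k e => e * (k : ℕ)) = Fintype.card H) :
    σ.cycleType = multisetOfProfile m ↔ cycleProfile σ = m := by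
  have hself : σ.cycleType = multisetOfProfile (cycleProfile σ) := by
    ext n
    by_cases hn : 2 ≤ n
    · have h2 : 1 < (⟨n, by omega⟩ : ℕ+) := by
        show (1 : ℕ) < n
        omega
      exact (count_cycleType σ ⟨n, by omega⟩ h2).trans
        (count_multisetOfProfile (cycleProfile σ) ⟨n, by omega⟩ h2).symm
    · rw [Multiset.count_eq_zero_of_notMem fun h =>
        hn (Equiv.Perm.two_le_of_mem_cycleType h),
        Multiset.count_eq_zero_of_notMem fun h => hn (two_le_of_mem_multisetOfProfile h)]
  constructor
  · intro h
    have h' : multisetOfProfile (cycleProfile σ) = multisetOfProfile m := hself.symm.trans h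
    ext k
    by_cases hk : k = 1
    · subst hk
      have e1 := cycleProfile_sum σ
      rw [← hm, sum_eq_add_erase, sum_eq_add_erase, h'] at e1
      omega
    · have hk1 : 1 < k := lt_of_le_of_ne (one_le) (Ne.symm hk)
      rw [← count_multisetOfProfile _ k hk1, h', count_multisetOfProfile _ k hk1]
  · rintro rfl
    exact hself

/-- The number of permutations with given numbers of cycles. -/
lemma card_cycleProfile_mul [Fintype H] [DecidableEq H] (m : ℕ+ →₀ ℕ)
    (hm : (m.sum fun k e => e * (k : ℕ)) = Fintype.card H) :
    (Finset.univ.filter fun σ : Equiv.Perm H => cycleProfile σ = m).card *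
      (m.prod fun k e => (k : ℕ) ^ e * e.factorial) = (Fintype.card H).factorial := by
  have h := Equiv.Perm.card_of_cycleType_mul_eq H (multisetOfProfile m)
  have hs := sum_eq_add_erase m
  rw [hm] at hs
  rw [if_pos ⟨by omega, fun a => two_le_of_mem_multisetOfProfile⟩] at h
  rw [← h]
  congr 1
  · congr 1
    ext σ
    simp [cycleType_eq_iff σ m hm]
  -- Fixed points contribute `(m 1)!` to both sides: `1 ^ m 1 = 1`, and the points outside the
  -- longer cycles number `m 1`.
  · rw [← Finsupp.mul_prod_erase' m 1 _ (by simp), hs, Nat.add_sub_cancel, mul_assoc (m 1).factorial]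
    refine congrArg₂ (· * ·) (by simp) ?_
    · rw [Finsupp.prod_mul]
      refine congrArg₂ (· * ·) ?_ ?_
      · rw [multisetOfProfile, Finsupp.prod_toMultiset, Finsupp.prod_embDomain]
        rfl
      · rw [multisetOfProfile, Finsupp.toFinset_toMultiset, Finsupp.support_embDomain,
          Finset.prod_map, Finsupp.prod]
        refine Finset.prod_congr rfl fun k hk => ?_
        rw [Finsupp.count_toMultiset, Finsupp.embDomain_apply_self]

end CycleProfile

/-! ## Contraction of tensors -/

section DualBasis

variable {V : Type*} [NormedAddCommGroup V] [InnerProductSpace ℝ V]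
  [FiniteDimensional ℝ V] {ι : Type*} [Fintype ι] [DecidableEq ι]

/-- The Gram matrix of the dual basis is inverse to that of the basis. Hence Wick's theorem, applied
to coordinate functions, puts the Casimir element on each edge. -/
lemma exists_dual_basis (b : Module.Basis ι ℝ V) :
    ∃ u : ι → V, (∀ i v, inner ℝ (u i) v = b.repr v i) ∧
      ∀ i j, inner ℝ (u i) (u j) = casimirMatrix b i j := by
  have : CompleteSpace V := FiniteDimensional.complete ℝ V
  obtain ⟨u, hu⟩ : ∃ u : ι → V, ∀ i v, inner ℝ (u i) v = b.repr v i :=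
    ⟨fun i => (InnerProductSpace.toDual ℝ V).symm (LinearMap.toContinuousLinearMap (b.coord i)),
      fun i v => by simp [InnerProductSpace.toDual_symm_apply]⟩
  refine ⟨u, hu, fun i j => ?_⟩
  have hM : casimirMatrix b = Matrix.of fun i j => inner ℝ (u i) (u j) := by
    refine Matrix.inv_eq_left_inv ?_
    ext i k
    -- As ⟨u_i, u_j⟩ is the j-th coordinate of u_i, the sum over j collapses to ⟨u_i, b_k⟩ = δ_{ik}.
    simp only [Matrix.mul_apply, Matrix.of_apply]
    have h1 : ∀ j, inner ℝ (u i) (u j) * inner ℝ (b j) (b k) =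
        inner ℝ (b.repr (u i) j • b j) (b k) := fun j => by
      rw [real_inner_smul_left, ← hu j (u i), real_inner_comm]
    rw [Finset.sum_congr rfl fun j _ => h1 j, ← sum_inner, b.sum_repr, hu, b.repr_self,
      Matrix.one_apply, Finsupp.single_apply]
    simp [eq_comm]
  rw [hM, Matrix.of_apply]

end DualBasis

namespace CyclicAlgebra

section Diag

variable {V : Type*} [NormedAddCommGroup V] [InnerProductSpace ℝ V]
  {ι : Type*} [Fintype ι]

lemma diag_eq_sum (A : CyclicAlgebra V) (b : Module.Basis ι ℝ V) (k : ℕ+) (w : V) :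
    A.diag k w = ∑ c : Fin k → ι, (∏ j, (b.repr w (c j) : ℂ)) *
      A.T k fun j => (1 : ℂ) ⊗ₜ[ℝ] b (c j) := by
  have h : (1 : ℂ) ⊗ₜ[ℝ] w = ∑ i, (b.repr w i : ℂ) • ((1 : ℂ) ⊗ₜ[ℝ] b i) := by
    conv_lhs => rw [← b.sum_repr w, TensorProduct.tmul_sum]
    refine Finset.sum_congr rfl fun i _ => ?_
    rw [TensorProduct.tmul_smul, TensorProduct.smul_tmul', TensorProduct.smul_tmul',
      Complex.real_smul, smul_eq_mul]
  rw [diag, h, MultilinearMap.map_sum]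
  refine Finset.sum_congr rfl fun c _ => ?_
  rw [MultilinearMap.map_smul_univ, smul_eq_mul]

/-- Going around the cycles of a permutation of the half-edges, the contraction of the tensors
with a coordinate vector at each half-edge. -/
lemma sum_prod_repr_mul_prod_tensor {H : Type*} [Fintype H] [DecidableEq H]
    (A : CyclicAlgebra V) (b : Module.Basis ι ℝ V) (σ : Equiv.Perm H) (w : V) :
    ∑ c : H → ι, (∏ h, (b.repr w (c h) : ℂ)) * ∏ q : CycleOrbit σ, A.T q.length
        (fun j => (1 : ℂ) ⊗ₜ[ℝ] b (c ((σ ^ (j : ℕ)) q.base))) =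
      (cycleProfile σ).prod fun k e => A.diag k w ^ e := by
  classical
  rw [← prod_length_eq]
  simp_rw [A.diag_eq_sum b]
  rw [Fintype.prod_sum]
  -- A colouring of the half-edges is the same as a colouring of the positions on each cycle, by the
  -- enumeration `enumEquiv`.
  refine Fintype.sum_equiv
    ((Equiv.arrowCongr (CycleOrbit.enumEquiv σ).symm (Equiv.refl ι)).trans
      (Equiv.piCurry fun _ _ => ι)) _ _ fun c => ?_
  rw [Finset.prod_mul_distrib]
  congr 1
  rw [← (CycleOrbit.enumEquiv σ).prod_comp, Fintype.prod_sigma]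
  rfl

end Diag

section Growth

variable {V : Type*} [NormedAddCommGroup V] [InnerProductSpace ℝ V] [FiniteDimensional ℝ V]

lemma polyGrowth_repr {ι : Type*} (b : Module.Basis ι ℝ V) (i : ι) :
    PolyGrowth fun v => b.repr v i :=
  PolyGrowth.clm (LinearMap.toContinuousLinearMap (b.coord i))

lemma polyGrowth_diag (A : CyclicAlgebra V) (k : ℕ+) : PolyGrowth (A.diag k) := by
  have b := Module.finBasis ℝ V
  rw [show A.diag k = _ from funext fun w => A.diag_eq_sum b k w]
  exact PolyGrowth.sum _ fun c _ =>
    (PolyGrowth.prod _ fun j _ => (polyGrowth_repr b (c j)).ofReal).mul (PolyGrowth.const _)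

end Growth

end CyclicAlgebra

/-! ## Ribbon graphs with labelled half-edges -/

namespace RibbonGraph

variable {H : Type*}

lemma ext_rot_flip {Γ Γ' : RibbonGraph H} (h1 : Γ.rot = Γ'.rot) (h2 : Γ.flip = Γ'.flip) :
    Γ = Γ' := by
  cases Γ
  cases Γ'
  simp only at h1 h2
  subst h1 h2
  rfl

instance [Finite H] : Finite (RibbonGraph H) :=
  Finite.of_injective (fun Γ : RibbonGraph H => (Γ.rot, Γ.flip)) fun _ _ h =>
    ext_rot_flip (congrArg Prod.fst h) (congrArg Prod.snd h)

instance [Finite H] : Fintype (RibbonGraph H) := Fintype.ofFinite _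

lemma edgeOf_eq_iff_eq_or (Γ : RibbonGraph H) {h h' : H} :
    Γ.edgeOf h = Γ.edgeOf h' ↔ h' = h ∨ h' = Γ.flip h := by
  rw [Γ.edgeOf_eq_iff]
  constructor
  · rintro ⟨n, rfl⟩
    have h2 : Γ.flip ^ (2 : ℤ) = 1 := by
      ext x
      rw [zpow_two, Equiv.Perm.mul_apply, Γ.flip_flip, Equiv.Perm.one_apply]
    rcases Int.even_or_odd' n with ⟨k, rfl | rfl⟩
    · left
      simp [zpow_mul, h2]
    · right
      simp [zpow_add, zpow_mul, h2]
  · rintro (rfl | rfl)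
    · exact Equiv.Perm.SameCycle.refl _ _
    · exact ⟨1, by simp⟩

/-- The graphical calculus uses an arbitrary half of each edge, Wick's theorem the smaller one;
symmetry of `F` makes the choice immaterial. -/
lemma prod_edge_eq [Fintype H] [LinearOrder H] (Γ : RibbonGraph H) {M : Type*} [CommMonoid M]
    (F : H → H → M) (hF : ∀ h h', F h h' = F h' h) :
    ∏ e : Γ.Edge, F (Γ.halfOf e) (Γ.flip (Γ.halfOf e)) =
      ∏ h with h < Γ.flip h, F h (Γ.flip h) := by
  symm
  refine Finset.prod_bij (fun h _ => Γ.edgeOf h) (fun _ _ => Finset.mem_univ _) ?_ ?_ ?_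
  · intro h hh h' hh' e
    simp only [Finset.mem_filter, Finset.mem_univ, true_and] at hh hh'
    rcases Γ.edgeOf_eq_iff_eq_or.1 e with rfl | rfl
    · rfl
    · rw [Γ.flip_flip] at hh'
      exact absurd hh (lt_asymm hh')
  · intro e _
    rcases lt_trichotomy (Γ.halfOf e) (Γ.flip (Γ.halfOf e)) with h | h | h
    · exact ⟨Γ.halfOf e, by simpa using h, Γ.edgeOf_halfOf e⟩
    · exact absurd h.symm (Γ.flip_ne _)
    · refine ⟨Γ.flip (Γ.halfOf e), by simpa [Γ.flip_flip] using h, ?_⟩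
      conv_rhs => rw [← Γ.edgeOf_halfOf e]
      rw [Γ.edgeOf_eq_iff_eq_or, Γ.flip_flip]
      exact Or.inr rfl
  · intro h _
    have he : Γ.edgeOf (Γ.halfOf (Γ.edgeOf h)) = Γ.edgeOf h := Γ.edgeOf_halfOf _
    rcases Γ.edgeOf_eq_iff_eq_or.1 he with e | e
    · rw [← e]
    · have e' : Γ.halfOf (Γ.edgeOf h) = Γ.flip h := by
        conv_rhs => rw [e, Γ.flip_flip]
      rw [e', Γ.flip_flip, hF]

/-- The numbers of vertices of each valence. -/
def profile [Finite H] (Γ : RibbonGraph H) : ℕ+ →₀ ℕ := cycleProfile Γ.rot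

lemma profile_eq [Finite H] (Γ : RibbonGraph H) :
    Γ.profile = ∑ v : Γ.Vertex, Finsupp.single (Γ.valence v) 1 := rfl

lemma prod_valence_eq [Finite H] (Γ : RibbonGraph H) {M : Type*} [CommMonoid M] (f : ℕ+ → M) :
    ∏ v : Γ.Vertex, f (Γ.valence v) = Γ.profile.prod fun k e => f k ^ e :=
  prod_length_eq Γ.rot f

lemma numVertices_eq_degree [Finite H] (Γ : RibbonGraph H) :
    Γ.numVertices = Γ.profile.degree := by
  rw [profile_eq, map_sum, numVertices, Nat.card_eq_fintype_card]
  simp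

lemma IsIso.profile_eq [Finite H] {H' : Type*} [Finite H'] {Γ : RibbonGraph H}
    {Γ' : RibbonGraph H'} {φ : H ≃ H'} (hφ : Γ.IsIso Γ' φ) : Γ.profile = Γ'.profile := by
  rw [Γ.profile_eq, Γ'.profile_eq]
  refine Fintype.sum_equiv hφ.vertexEquiv _ _ fun v => ?_
  rw [hφ.valence_eq]

end RibbonGraph

/-! ### Gaussian integrals as sums over labelled ribbon graphs -/

section LabelledSum

variable {V : Type*} [NormedAddCommGroup V] [InnerProductSpace ℝ V]
  {ι : Type*} [Fintype ι] [DecidableEq ι]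

namespace CyclicAlgebra

/-- The coefficients can be extracted from the graphical calculus. -/
lemma graphZ_eq_prod_mul {R H : Type*} [CommRing R] [Algebra ℂ R] [Fintype H] [DecidableEq H]
    (A : CyclicAlgebra V) (b : Module.Basis ι ℝ V) (x : ℕ+ → R) (Γ : RibbonGraph H) :
    A.graphZ b x Γ =
      (Γ.profile.prod fun k e => x k ^ e) * algebraMap ℂ R (A.graphZ b (fun _ => (1 : ℂ)) Γ) := by
  rw [← Γ.prod_valence_eq, graphZ, graphZ, map_sum, Finset.mul_sum]
  refine Finset.sum_congr rfl fun c _ => ?_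
  simp only [Finset.prod_mul_distrib, map_mul, map_prod, one_mul,
    Algebra.algebraMap_self, RingHom.id_apply]
  ring

variable [FiniteDimensional ℝ V] [MeasurableSpace V] [BorelSpace V]

/-- Once the rotation is fixed, a ribbon graph is just a pairing of all the half-edges, so this is
Wick's theorem for the dual basis vectors `u (c h)`. -/
lemma integral_prod_repr {N : ℕ} (b : Module.Basis ι ℝ V)
    (σ : Equiv.Perm (Fin N)) (c : Fin N → ι) :
    ∑ Γ : RibbonGraph (Fin N) with Γ.rot = σ, ∏ e : Γ.Edge, edgeFactor b Γ c e =
      ∫ v, ∏ h, b.repr v (c h) ∂gaussianMeasure V := by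
  obtain ⟨u, hu, huu⟩ := exists_dual_basis b
  have hw := integral_prod_inner (V := V) (fun h => u (c h)) Finset.univ
  simp only [hu] at hw
  rw [hw]
  refine Finset.sum_bij' (fun Γ _ => Γ.flip) (fun f hf => ⟨σ, f, (mem_pairings.1 hf).1,
    fun h => ((mem_pairings.1 hf).2 h).2 (Finset.mem_univ _)⟩) ?_ ?_ ?_ ?_ ?_
  · intro Γ _
    rw [mem_pairings]
    exact ⟨Γ.flip_flip, fun h => by simp [Γ.flip_ne]⟩
  · intro f hf
    simp
  · intro Γ hΓ
    simp only [Finset.mem_filter, Finset.mem_univ, true_and] at hΓ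
    exact RibbonGraph.ext_rot_flip hΓ.symm rfl
  · intro f hf
    rfl
  · intro Γ _
    unfold edgeFactor
    rw [Γ.prod_edge_eq (fun h h' => casimirMatrix b (c h) (c h'))
      fun h h' => casimirMatrix_symm b _ _]
    refine Finset.prod_congr rfl fun h _ => ?_
    rw [← huu, hu]

/-- The vertex factors depend only on the rotation and the colouring, so the sum over flips acts on
the edge factors alone and becomes an integral; the colourings are then summed under the integral
sign. -/
lemma sum_graphZ_of_rot_eq {N : ℕ} (A : CyclicAlgebra V) (b : Module.Basis ι ℝ V)
    (σ : Equiv.Perm (Fin N)) :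
    ∑ Γ : RibbonGraph (Fin N) with Γ.rot = σ, A.graphZ b (fun _ => (1 : ℂ)) Γ =
      ∫ w, (cycleProfile σ).prod (fun k e => A.diag k w ^ e) ∂gaussianMeasure V := by
  have hZ : ∀ Γ : RibbonGraph (Fin N), Γ.rot = σ → A.graphZ b (fun _ => (1 : ℂ)) Γ =
      ∑ c : Fin N → ι, ((∏ e : Γ.Edge, edgeFactor b Γ c e : ℝ) : ℂ) *
        ∏ q : CycleOrbit σ, A.T q.length
          (fun j => (1 : ℂ) ⊗ₜ[ℝ] b (c ((σ ^ (j : ℕ)) q.base))) := by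
    rintro Γ rfl
    rw [graphZ]
    refine Finset.sum_congr rfl fun c _ => ?_
    simp only [one_mul, Algebra.algebraMap_self, RingHom.id_apply, Complex.ofReal_prod]
    rfl
  rw [Finset.sum_congr rfl fun Γ hΓ => hZ Γ (Finset.mem_filter.1 hΓ).2, Finset.sum_comm]
  simp_rw [← Finset.sum_mul, ← Complex.ofReal_sum, integral_prod_repr,
    ← A.sum_prod_repr_mul_prod_tensor b]
  rw [integral_finsetSum]
  · refine Finset.sum_congr rfl fun c _ => ?_
    rw [integral_mul_const]
    congr 1
    simp only [← Complex.ofReal_prod]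
    exact integral_ofReal.symm
  · intro c _
    exact ((PolyGrowth.prod _ fun h _ => (polyGrowth_repr b (c h)).ofReal).mul
      (PolyGrowth.const _)).integrable

/-- All rotations of profile `m` contribute the same integral. Their number, N! / ∏ k^{m_k} m_k!, is
the origin of the 1/k in the potential and of the factorials of the exponential. -/
lemma sum_graphZ_of_profile_eq {N : ℕ} (A : CyclicAlgebra V) (b : Module.Basis ι ℝ V)
    (m : ℕ+ →₀ ℕ) (hm : (m.sum fun k e => e * (k : ℕ)) = N) :
    ∑ Γ : RibbonGraph (Fin N) with Γ.profile = m, A.graphZ b (fun _ => (1 : ℂ)) Γ =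
      (N.factorial : ℂ) * ∫ w, m.prod (fun k e => (A.diag k w / (k : ℂ)) ^ e / (e.factorial : ℂ))
        ∂gaussianMeasure V := by
  have hcard := card_cycleProfile_mul (H := Fin N) m (by simpa using hm)
  rw [Fintype.card_fin] at hcard
  rw [← Finset.sum_fiberwise_of_maps_to (g := fun Γ : RibbonGraph (Fin N) => Γ.rot)
    (t := Finset.univ.filter fun σ : Equiv.Perm (Fin N) => cycleProfile σ = m)
    (fun Γ hΓ => by
      rw [Finset.mem_filter] at hΓ ⊢
      exact ⟨Finset.mem_univ _, hΓ.2⟩)]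
  have h1 : ∀ σ ∈ Finset.univ.filter (fun σ : Equiv.Perm (Fin N) => cycleProfile σ = m),
      ∑ Γ ∈ Finset.univ.filter (fun Γ : RibbonGraph (Fin N) => Γ.profile = m) with Γ.rot = σ,
        A.graphZ b (fun _ => (1 : ℂ)) Γ =
      ∫ w, m.prod (fun k e => A.diag k w ^ e) ∂gaussianMeasure V := by
    intro σ hσ
    rw [Finset.mem_filter] at hσ
    obtain ⟨-, rfl⟩ := hσ
    rw [← A.sum_graphZ_of_rot_eq b, Finset.filter_filter]
    refine Finset.sum_congr (Finset.filter_congr fun Γ _ => ?_) fun _ _ => rfl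
    exact ⟨fun h => h.2, fun h => ⟨by rw [← h]; rfl, h⟩⟩
  rw [Finset.sum_congr rfl h1, Finset.sum_const, nsmul_eq_mul, ← hcard]
  push_cast
  rw [mul_assoc]
  refine congrArg _ ?_
  rw [← integral_const_mul]
  refine congrArg _ (funext fun w => ?_)
  rw [Finsupp.prod, Finsupp.prod, Finsupp.prod, ← Finset.prod_mul_distrib]
  refine Finset.prod_congr rfl fun k _ => ?_
  have h2 : ((k : ℕ) : ℂ) ≠ 0 := by exact_mod_cast k.pos.ne'
  have h3 : ((m k).factorial : ℂ) ≠ 0 := by exact_mod_cast (m k).factorial_ne_zero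
  rw [div_pow]
  field_simp

end CyclicAlgebra

end LabelledSum

/-! ## Isomorphism classes and orbit counting -/

namespace RibbonGraph

variable {H : Type*}

/-- Transport of structure along a permutation of the half-edges. -/
def relabel (Γ : RibbonGraph H) (φ : Equiv.Perm H) : RibbonGraph H where
  rot := φ * Γ.rot * φ⁻¹
  flip := φ * Γ.flip * φ⁻¹
  flip_flip h := by simp [Γ.flip_flip]
  flip_ne h hh := by
    simp only [Equiv.Perm.mul_apply] at hh
    rw [← Equiv.eq_symm_apply] at hh
    exact Γ.flip_ne _ hh

/-- Isomorphism classes on a fixed set of half-edges are thus orbits under simultaneous conjugation,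
with the automorphism groups as stabilizers. -/
lemma isIso_iff_eq_relabel (Γ Γ' : RibbonGraph H) (φ : Equiv.Perm H) :
    Γ.IsIso Γ' φ ↔ Γ' = Γ.relabel φ := by
  constructor
  · intro hφ
    refine ext_rot_flip (Equiv.ext fun h => ?_) (Equiv.ext fun h => ?_)
    · simp [relabel, hφ.1]
    · simp [relabel, hφ.2]
  · rintro rfl
    exact ⟨fun h => by simp [relabel], fun h => by simp [relabel]⟩

instance [Finite H] (Γ : RibbonGraph H) : Finite Γ.Aut :=
  inferInstanceAs (Finite {φ : H ≃ H // Γ.IsIso Γ φ})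

lemma card_aut_pos [Finite H] (Γ : RibbonGraph H) : 0 < Nat.card Γ.Aut :=
  haveI : Nonempty Γ.Aut := ⟨⟨_, IsIso.refl Γ⟩⟩
  Nat.card_pos

lemma card_isIso_eq {Γ Γ' : RibbonGraph H} {φ : Equiv.Perm H} (hφ : Γ.IsIso Γ' φ) :
    Nat.card {ψ : Equiv.Perm H // Γ.IsIso Γ' ψ} = Nat.card Γ.Aut :=
  Nat.card_congr
    { toFun := fun ψ => ⟨ψ.1.trans φ.symm, ψ.2.trans hφ.symm⟩
      invFun := fun ψ => ⟨ψ.1.trans φ, ψ.2.trans hφ⟩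
      left_inv := fun ψ => Subtype.ext (by ext h; simp)
      right_inv := fun ψ => Subtype.ext (by ext h; simp) }

/-- Orbit counting for the action of the permutations of the half-edges. -/
lemma card_isomorphic_mul_card_aut [Fintype H] [DecidableEq H] (Γ : RibbonGraph H)
    [DecidablePred fun Γ' : RibbonGraph H => ∃ φ, Γ.IsIso Γ' φ] :
    (Finset.univ.filter fun Γ' : RibbonGraph H => ∃ φ, Γ.IsIso Γ' φ).card * Nat.card Γ.Aut =
      (Fintype.card H).factorial := by
  classical
  -- Sort all permutations φ by the graph `Γ.relabel φ`; each nonempty fibre has |Aut Γ| elements,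
  -- by composition with a fixed isomorphism.
  rw [← Fintype.card_perm, ← Finset.card_univ, Finset.card_eq_sum_card_fiberwise
    (f := fun φ : Equiv.Perm H => Γ.relabel φ)
    (t := Finset.univ.filter fun Γ' : RibbonGraph H => ∃ φ, Γ.IsIso Γ' φ)
    (fun φ _ => by
      rw [Finset.mem_coe, Finset.mem_filter]
      exact ⟨Finset.mem_univ _, φ, (Γ.isIso_iff_eq_relabel _ φ).2 rfl⟩)]
  rw [Finset.sum_const_nat]
  intro Γ' hΓ'
  obtain ⟨φ, hφ⟩ := (Finset.mem_filter.1 hΓ').2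
  rw [← card_isIso_eq hφ, Nat.card_eq_fintype_card, Fintype.card_subtype]
  congr 1
  ext ψ
  simp [isIso_iff_eq_relabel, eq_comm]

end RibbonGraph

namespace RibbonClass

/-- The isomorphism class of a labelled ribbon graph. -/
def of {N : ℕ} (Γ : RibbonGraph (Fin N)) : RibbonClass :=
  Quotient.mk RibbonGraph.isoSetoid ⟨N, Γ⟩

lemma exists_of (q : RibbonClass) : ∃ (N : ℕ) (Γ : RibbonGraph (Fin N)), q = of Γ := by
  induction q using Quotient.inductionOn with
  | h Γ => exact ⟨Γ.1, Γ.2, rfl⟩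

lemma of_eq_iff {N : ℕ} {Γ Γ' : RibbonGraph (Fin N)} :
    of Γ = of Γ' ↔ ∃ φ, Γ.IsIso Γ' φ :=
  Quotient.eq (r := RibbonGraph.isoSetoid)

/-- The numbers of vertices of each valence. -/
def profile (q : RibbonClass) : ℕ+ →₀ ℕ :=
  Quotient.lift (s := RibbonGraph.isoSetoid) (fun Γ : RibbonGraph.Labelled => Γ.2.profile)
    (fun _ _ h => h.elim fun _ hφ => hφ.profile_eq) q

lemma profile_of {N : ℕ} (Γ : RibbonGraph (Fin N)) : (of Γ).profile = Γ.profile := rfl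

lemma numVertices_eq_degree (q : RibbonClass) : q.numVertices = q.profile.degree := by
  obtain ⟨N, Γ, rfl⟩ := q.exists_of
  exact Γ.numVertices_eq_degree

open Classical in
/-- The finite set of isomorphism classes with given numbers of vertices of each valence. -/
def withProfile (m : ℕ+ →₀ ℕ) : Finset RibbonClass :=
  (Finset.univ.filter fun Γ : RibbonGraph (Fin (m.sum fun k e => e * (k : ℕ))) =>
    Γ.profile = m).image of

lemma mem_withProfile {m : ℕ+ →₀ ℕ} {q : RibbonClass} :
    q ∈ withProfile m ↔ q.profile = m := by
  simp only [withProfile, Finset.mem_image, Finset.mem_filter, Finset.mem_univ, true_and]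
  constructor
  · rintro ⟨Γ, hΓ, rfl⟩
    exact hΓ
  · intro h
    obtain ⟨N, Γ, rfl⟩ := q.exists_of
    obtain rfl : (m.sum fun k e => e * (k : ℕ)) = N := by
      rw [← h, profile_of, RibbonGraph.profile, cycleProfile_sum, Fintype.card_fin]
    exact ⟨Γ, h, rfl⟩

lemma cardAut_ne_zero (q : RibbonClass) : (q.cardAut : ℂ) ≠ 0 := by
  obtain ⟨N, Γ, rfl⟩ := q.exists_of
  exact_mod_cast Γ.card_aut_pos.ne'

section GraphZ

variable {V : Type*} [NormedAddCommGroup V] [InnerProductSpace ℝ V]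
  {ι : Type*} [Fintype ι] [DecidableEq ι]

lemma graphZ_eq_prod_mul {R : Type*} [CommRing R] [Algebra ℂ R]
    (A : CyclicAlgebra V) (b : Module.Basis ι ℝ V) (x : ℕ+ → R) (q : RibbonClass) :
    q.graphZ A b x =
      (q.profile.prod fun k e => x k ^ e) * algebraMap ℂ R (q.graphZ A b (fun _ => (1 : ℂ))) := by
  obtain ⟨N, Γ, rfl⟩ := q.exists_of
  exact A.graphZ_eq_prod_mul b x Γ

/-- At formal variables the graphical value is a number times the monomial of the profile, so a
class contributes to one coefficient only. -/
lemma coeff_smul_graphZ_X (A : CyclicAlgebra V) (b : Module.Basis ι ℝ V) (m : ℕ+ →₀ ℕ)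
    (q : RibbonClass) :
    MvPowerSeries.coeff m
      ((q.cardAut : ℂ)⁻¹ • q.graphZ A b (MvPowerSeries.X (R := ℂ))) =
      if q.profile = m then q.graphZ A b (fun _ => (1 : ℂ)) / (q.cardAut : ℂ) else 0 := by
  classical
  rw [graphZ_eq_prod_mul, ← MvPowerSeries.monomial_one_eq, map_smul,
    MvPowerSeries.algebraMap_apply, MvPowerSeries.coeff_mul_C, MvPowerSeries.coeff_monomial,
    smul_eq_mul]
  simp only [Algebra.algebraMap_self, RingHom.id_apply, eq_comm (a := m)]
  split_ifs
  · ring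
  · ring

variable [FiniteDimensional ℝ V] [MeasurableSpace V] [BorelSpace V]

/-- The sum over the ribbon graphs with given numbers of vertices of each valence. -/
lemma sum_withProfile_graphZ_div (A : CyclicAlgebra V) (b : Module.Basis ι ℝ V)
    (m : ℕ+ →₀ ℕ) :
    ∑ q ∈ withProfile m, q.graphZ A b (fun _ => (1 : ℂ)) / (q.cardAut : ℂ) =
      ∫ w, m.prod (fun k e => (A.diag k w / (k : ℂ)) ^ e / (e.factorial : ℂ))
        ∂gaussianMeasure V := by
  classical
  have h := A.sum_graphZ_of_profile_eq b m rfl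
  set N := m.sum fun k e => e * (k : ℕ) with hN
  have hN0 : (N.factorial : ℂ) ≠ 0 := by exact_mod_cast N.factorial_ne_zero
  -- After multiplication by N!, both sides are sums over labelled graphs, grouped by class; a class
  -- has N! / |Aut| labelled members.
  rw [← mul_right_inj' hN0, ← h, Finset.mul_sum, ← Finset.sum_fiberwise_of_maps_to
    (s := Finset.univ.filter fun Γ : RibbonGraph (Fin N) => Γ.profile = m)
    (g := of) (t := withProfile m) (fun Γ hΓ => by
      rw [Finset.mem_filter] at hΓ
      rw [mem_withProfile]
      exact hΓ.2)]
  refine Finset.sum_congr rfl fun q hq => ?_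
  obtain ⟨Γ, hΓ, rfl⟩ := Finset.mem_image.1 hq
  have hΓm : Γ.profile = m := (Finset.mem_filter.1 hΓ).2
  have hfib : (Finset.univ.filter fun Γ' : RibbonGraph (Fin N) => Γ'.profile = m).filter
      (fun Γ' => of Γ' = of Γ) =
      Finset.univ.filter fun Γ' : RibbonGraph (Fin N) => ∃ φ, Γ.IsIso Γ' φ := by
    ext Γ'
    simp only [Finset.mem_filter, Finset.mem_univ, true_and]
    rw [eq_comm, ← of_eq_iff]
    refine ⟨fun h => h.2.symm, fun h => ⟨?_, h.symm⟩⟩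
    rw [← hΓm, ← profile_of Γ, h, profile_of]
  have hconst : ∀ Γ' ∈ Finset.univ.filter fun Γ' : RibbonGraph (Fin N) => ∃ φ, Γ.IsIso Γ' φ,
      A.graphZ b (fun _ => (1 : ℂ)) Γ' = (of Γ).graphZ A b (fun _ => (1 : ℂ)) := by
    intro Γ' hΓ'
    obtain ⟨φ, hφ⟩ := (Finset.mem_filter.1 hΓ').2
    exact (A.graphZ_eq_of_isIso b _ hφ).symm
  have hcard := Γ.card_isomorphic_mul_card_aut
  rw [Fintype.card_fin] at hcard
  have hcard' : ((Finset.univ.filter fun Γ' : RibbonGraph (Fin N) => ∃ φ, Γ.IsIso Γ' φ).card : ℂ)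
      * ((of Γ).cardAut : ℂ) = (N.factorial : ℂ) := by
    rw [← hcard]
    push_cast
    rfl
  rw [hfib, Finset.sum_congr rfl hconst, Finset.sum_const, nsmul_eq_mul, ← hcard']
  have := (of Γ).cardAut_ne_zero
  field_simp

end GraphZ

end RibbonClass

/-! ## The exponential series -/

lemma Finsupp.exists_eq_single_of_degree_eq_one {α : Type*} {q : α →₀ ℕ} (hq : q.degree = 1) :
    ∃ k, q = Finsupp.single k 1 := by
  classical
  have h0 : q ≠ 0 := by
    rintro rfl
    simp at hq
  obtain ⟨k, hk⟩ := Finsupp.support_nonempty_iff.2 h0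
  have hle : Finsupp.single k 1 ≤ q := by
    rw [Finsupp.single_le_iff]
    exact Nat.one_le_iff_ne_zero.2 (Finsupp.mem_support_iff.1 hk)
  obtain ⟨p, rfl⟩ := exists_add_of_le hle
  rw [map_add, Finsupp.degree_single] at hq
  have hp : p = 0 := (Finsupp.degree_eq_zero_iff p).1 (by omega)
  exact ⟨k, by rw [hp, add_zero]⟩

lemma coeff_linearSeries_single (a : ℕ+ → ℂ) (k : ℕ+) :
    MvPowerSeries.coeff (Finsupp.single k 1) (linearSeries a) = a k := by
  show linearSeries a (Finsupp.single k 1) = a k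
  rw [linearSeries, if_pos (by simp)]
  simp

lemma coeff_linearSeries_of_ne (a : ℕ+ → ℂ) {m : ℕ+ →₀ ℕ} (hm : m.degree ≠ 1) :
    MvPowerSeries.coeff m (linearSeries a) = 0 :=
  if_neg hm

/-- The identity (a^e / e!) · e = (a^{e−1} / (e−1)!) · a in the variable `k`; it drives the
induction in `coeff_linearSeries_pow`. -/
lemma prod_pow_div_factorial_single_add (a : ℕ+ → ℂ) (k : ℕ+) (p : ℕ+ →₀ ℕ) :
    ((Finsupp.single k 1 + p).prod fun i e => a i ^ e / (e.factorial : ℂ)) *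
      (((Finsupp.single k 1 + p : ℕ+ →₀ ℕ) k : ℕ) : ℂ) =
      (p.prod fun i e => a i ^ e / (e.factorial : ℂ)) * a k := by
  rw [← Finsupp.mul_prod_erase' (Finsupp.single k 1 + p) k _ (by simp),
    ← Finsupp.mul_prod_erase' p k _ (by simp), Finsupp.erase_add, Finsupp.erase_single, zero_add,
    Finsupp.add_apply, Finsupp.single_eq_same, add_comm 1, Nat.factorial_succ]
  push_cast
  have h1 : (p k : ℂ) + 1 ≠ 0 := by exact_mod_cast (p k).succ_ne_zero
  have h2 : ((p k).factorial : ℂ) ≠ 0 := by exact_mod_cast (p k).factorial_ne_zero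
  field_simp
  ring

/-- The multinomial theorem for infinitely many variables. In the product with one more linear
factor only the splittings `m = single k 1 + q` survive. -/
lemma coeff_linearSeries_pow (a : ℕ+ → ℂ) (d : ℕ) (m : ℕ+ →₀ ℕ) :
    MvPowerSeries.coeff m (linearSeries a ^ d) =
      if m.degree = d then (d.factorial : ℂ) * m.prod fun k e => a k ^ e / (e.factorial : ℂ)
      else 0 := by
  classical
  induction d generalizing m with
  | zero =>
    rw [pow_zero, MvPowerSeries.coeff_one]
    simp only [Finsupp.degree_eq_zero_iff]
    split_ifs with h
    · simp [h]
    · rfl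
  | succ d ih =>
    have hsub : ∀ k ∈ m.support, Finsupp.single k 1 + (m - Finsupp.single k 1) = m := by
      intro k hk
      refine add_tsub_cancel_of_le ?_
      rw [Finsupp.single_le_iff]
      exact Nat.one_le_iff_ne_zero.2 (Finsupp.mem_support_iff.1 hk)
    rw [pow_succ', MvPowerSeries.coeff_mul, ← Finset.sum_of_injOn (s := m.support)
      (f := fun k => a k * MvPowerSeries.coeff (m - Finsupp.single k 1) (linearSeries a ^ d))
      (fun k => (Finsupp.single k 1, m - Finsupp.single k 1))]
    · rw [Finset.sum_congr rfl fun k _ => by rw [ih]]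
      split_ifs with hm
      · have hterm : ∀ k ∈ m.support, (a k *
            if (m - Finsupp.single k 1).degree = d then
              (d.factorial : ℂ) * (m - Finsupp.single k 1).prod
                fun k e => a k ^ e / (e.factorial : ℂ) else 0) =
            ((m k : ℕ) : ℂ) *
              ((d.factorial : ℂ) * m.prod fun k e => a k ^ e / (e.factorial : ℂ)) := by
          intro k hk
          have hd := congrArg Finsupp.degree (hsub k hk)
          rw [map_add, Finsupp.degree_single] at hd
          rw [if_pos (by omega)]
          have hp := prod_pow_div_factorial_single_add a k (m - Finsupp.single k 1)
          rw [hsub k hk] at hp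
          linear_combination -(d.factorial : ℂ) * hp
        -- The splitting at `k` has weight `m k`, and these weights add up to the degree d + 1,
        -- which turns d! into (d+1)!.
        rw [Finset.sum_congr rfl hterm, ← Finset.sum_mul, ← Nat.cast_sum,
          show ∑ k ∈ m.support, m k = d + 1 from hm, Nat.factorial_succ]
        push_cast
        ring
      · refine Finset.sum_eq_zero fun k hk => ?_
        have hd := congrArg Finsupp.degree (hsub k hk)
        rw [map_add, Finsupp.degree_single] at hd
        rw [if_neg (by omega), mul_zero]
    · intro k _ k' _ h
      exact Finsupp.single_left_injective one_ne_zero (congrArg Prod.fst h)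
    · intro k hk
      rw [Finset.mem_coe, Finset.HasAntidiagonal.mem_antidiagonal]
      exact hsub k hk
    · rintro ⟨p, q⟩ hpq hne
      rw [Finset.HasAntidiagonal.mem_antidiagonal] at hpq
      by_cases hp : p.degree = 1
      · obtain ⟨k, rfl⟩ := Finsupp.exists_eq_single_of_degree_eq_one hp
        refine absurd ⟨k, ?_, ?_⟩ hne
        · rw [Finset.mem_coe, Finsupp.mem_support_iff, ← hpq]
          simp
        · simp only [← hpq, add_tsub_cancel_left]
      · rw [coeff_linearSeries_of_ne a hp, zero_mul]
    · intro k _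
      rw [coeff_linearSeries_single]

lemma sum_pow_div_factorial {α : Type*} [DecidableEq α] (K : Finset α) (y : α → ℂ) (j : ℕ) :
    (∑ k ∈ K, y k) ^ j / (j.factorial : ℂ) =
      ∑ m ∈ K.finsuppAntidiag j, m.prod fun k e => y k ^ e / (e.factorial : ℂ) := by
  rw [Finset.sum_pow_eq_sum_piAntidiag, Finset.sum_div]
  symm
  refine Finset.sum_bij (fun m _ => ⇑m) ?_ ?_ ?_ ?_
  · intro m hm
    rw [Finset.mem_finsuppAntidiag] at hm
    rw [Finset.mem_piAntidiag]
    exact ⟨hm.1, fun i hi => hm.2 (Finsupp.mem_support_iff.2 hi)⟩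
  · intro m _ m' _ h
    exact DFunLike.coe_injective h
  · intro f hf
    rw [Finset.mem_piAntidiag] at hf
    refine ⟨Finsupp.onFinset K f hf.2, ?_, rfl⟩
    rw [Finset.mem_finsuppAntidiag]
    exact ⟨hf.1, Finsupp.support_onFinset_subset⟩
  · intro m hm
    rw [Finset.mem_finsuppAntidiag] at hm
    have hs := Nat.multinomial_spec K m
    rw [hm.1] at hs
    rw [Finsupp.prod_of_support_subset _ hm.2 _ (by simp), Finset.prod_div_distrib, ← hs]
    push_cast
    have h1 : ∏ k ∈ K, ((m k).factorial : ℂ) ≠ 0 :=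
      Finset.prod_ne_zero_iff.2 fun k _ => by exact_mod_cast (m k).factorial_ne_zero
    have h2 : (Nat.multinomial K m : ℂ) ≠ 0 := by
      exact_mod_cast (Nat.multinomial_pos K m).ne'
    field_simp

namespace CyclicAlgebra

variable {V : Type*} [NormedAddCommGroup V] [InnerProductSpace ℝ V]

/-- The substituted series is homogeneous of degree one, so only its power of exponent `m.degree`
reaches the monomial `m`, and the factorial of the degree cancels. -/
lemma coeff_expSeries (A : CyclicAlgebra V) (v : V) (m : ℕ+ →₀ ℕ) :
    MvPowerSeries.coeff m (A.expSeries v) =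
      m.prod fun k e => (A.diag k v / (k : ℂ)) ^ e / (e.factorial : ℂ) := by
  have hs : PowerSeries.HasSubst (linearSeries fun k => A.diag k v / (k : ℂ)) := by
    refine PowerSeries.HasSubst.of_constantCoeff_zero ?_
    rw [← MvPowerSeries.coeff_zero_eq_constantCoeff_apply]
    exact coeff_linearSeries_of_ne _ (by simp)
  rw [expSeries, PowerSeries.coeff_subst hs, finsum_eq_single _ m.degree]
  · rw [coeff_linearSeries_pow, if_pos rfl, PowerSeries.coeff_exp]
    have : (m.degree.factorial : ℂ) ≠ 0 := by exact_mod_cast m.degree.factorial_ne_zero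
    rw [smul_eq_mul, ← mul_assoc]
    simp [this]
  · intro d hd
    rw [coeff_linearSeries_pow, if_neg hd.symm, smul_zero]

lemma potential_eq_sum (A : CyclicAlgebra V) {K : Finset ℕ+} {x : ℕ+ → ℂ}
    (hx : ∀ k, k ∉ K → x k = 0) (v : V) :
    A.potential x v = ∑ k ∈ K, x k * (A.diag k v / (k : ℂ)) := by
  rw [potential, tsum_eq_sum (s := K) fun k hk => by rw [hx k hk]; simp]
  simp only [mul_div_assoc]

/-- Separates the size of `x` from the growth in `v`, for a remainder constant independent of `x`;
the factors 1/k ≤ 1 are dropped. -/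
lemma norm_potential_le (A : CyclicAlgebra V) {K : Finset ℕ+} {x : ℕ+ → ℂ}
    (hx : ∀ k, k ∉ K → x k = 0) (v : V) :
    ‖A.potential x v‖ ≤ (∑ k ∈ K, ‖x k‖) * ∑ k ∈ K, ‖A.diag k v‖ := by
  rw [A.potential_eq_sum hx, Finset.sum_mul]
  refine (norm_sum_le _ _).trans (Finset.sum_le_sum fun k hk => ?_)
  rw [norm_mul, norm_div]
  refine mul_le_mul_of_nonneg_left ?_ (norm_nonneg _)
  have h1 : (1 : ℝ) ≤ ‖((k : ℕ) : ℂ)‖ := by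
    rw [Complex.norm_natCast]
    exact_mod_cast k.pos
  exact (div_le_self (norm_nonneg _) h1).trans
    (Finset.single_le_sum (f := fun k => ‖A.diag k v‖) (fun _ _ => norm_nonneg _) hk)

end CyclicAlgebra

/-! ## The asymptotic expansion -/

namespace RibbonClass

open Classical in
/-- The isomorphism classes with at most `n` vertices, all of valence in `K`. -/
def boundedBy (K : Finset ℕ+) (n : ℕ) : Finset RibbonClass :=
  (Finset.range (n + 1)).biUnion fun j => (K.finsuppAntidiag j).biUnion withProfile

lemma mem_boundedBy {K : Finset ℕ+} {n : ℕ} {q : RibbonClass} :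
    q ∈ boundedBy K n ↔ q.numVertices ≤ n ∧ q.profile.support ⊆ K := by
  simp only [boundedBy, Finset.mem_biUnion, Finset.mem_range, mem_withProfile,
    Finset.mem_finsuppAntidiag', Nat.lt_succ_iff, q.numVertices_eq_degree]
  constructor
  · rintro ⟨j, hj, m, ⟨hm, hK⟩, rfl⟩
    exact ⟨hm.trans_le hj, hK⟩
  · rintro ⟨hn, hK⟩
    exact ⟨_, hn, _, ⟨rfl, hK⟩, rfl⟩

lemma sum_boundedBy {M : Type*} [AddCommMonoid M] (K : Finset ℕ+) (n : ℕ)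
    (f : RibbonClass → M) :
    ∑ q ∈ boundedBy K n, f q =
      ∑ j ∈ Finset.range (n + 1), ∑ m ∈ K.finsuppAntidiag j, ∑ q ∈ withProfile m, f q := by
  classical
  rw [boundedBy, Finset.sum_biUnion]
  · refine Finset.sum_congr rfl fun j _ => Finset.sum_biUnion fun m _ m' _ hm => ?_
    rw [Function.onFun, Finset.disjoint_left]
    intro q hq hq'
    exact hm ((mem_withProfile.1 hq).symm.trans (mem_withProfile.1 hq'))
  · intro j _ j' _ hj
    rw [Function.onFun, Finset.disjoint_left]
    intro q hq hq'
    simp only [Finset.mem_biUnion, mem_withProfile, Finset.mem_finsuppAntidiag'] at hq hq'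
    obtain ⟨m, ⟨hm, -⟩, rfl⟩ := hq
    obtain ⟨m', ⟨hm', -⟩, h⟩ := hq'
    exact hj (hm.symm.trans ((congrArg (fun m : ℕ+ →₀ ℕ => m.sum fun _ x => x) h).trans hm'))

section

variable {V : Type*} [NormedAddCommGroup V] [InnerProductSpace ℝ V]
  {ι : Type*} [Fintype ι] [DecidableEq ι]

/-- A vertex with valence outside `K` carries the coefficient 0. -/
lemma support_profile_subset (A : CyclicAlgebra V) (b : Module.Basis ι ℝ V) {K : Finset ℕ+}
    {x : ℕ+ → ℂ} (hx : ∀ k, k ∉ K → x k = 0) {q : RibbonClass} (hq : q.graphZ A b x ≠ 0) :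
    q.profile.support ⊆ K := by
  intro k hk
  by_contra hkK
  refine hq ?_
  rw [graphZ_eq_prod_mul, Finsupp.prod, Finset.prod_eq_zero hk, zero_mul]
  rw [hx k hkK, zero_pow (Finsupp.mem_support_iff.1 hk)]

variable [FiniteDimensional ℝ V] [MeasurableSpace V] [BorelSpace V]

/-- The number of vertices is the degree in the coefficients: graphs with j vertices give the j-th
term of the exponential, which the multinomial theorem splits by profile. -/
lemma sum_boundedBy_graphZ_div (A : CyclicAlgebra V) (b : Module.Basis ι ℝ V) {K : Finset ℕ+}
    {x : ℕ+ → ℂ} (hx : ∀ k, k ∉ K → x k = 0) (n : ℕ) :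
    ∑ q ∈ boundedBy K n, q.graphZ A b x / (q.cardAut : ℂ) =
      ∫ v, ∑ j ∈ Finset.range (n + 1), A.potential x v ^ j / (j.factorial : ℂ)
        ∂gaussianMeasure V := by
  have hterm : ∀ m : ℕ+ →₀ ℕ, PolyGrowth fun v : V =>
      m.prod fun k e => (x k * (A.diag k v / (k : ℂ))) ^ e / (e.factorial : ℂ) := fun m =>
    PolyGrowth.prod _ fun k _ => by
      simp only [div_eq_mul_inv]
      exact (((PolyGrowth.const _).mul ((A.polyGrowth_diag k).mul (PolyGrowth.const _))).pow _).mul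
        (PolyGrowth.const _)
  simp_rw [A.potential_eq_sum hx, sum_pow_div_factorial]
  rw [sum_boundedBy, integral_finsetSum _ fun j _ =>
    (PolyGrowth.sum _ fun m _ => hterm m).integrable]
  refine Finset.sum_congr rfl fun j _ => ?_
  rw [integral_finsetSum _ fun m _ => (hterm m).integrable]
  refine Finset.sum_congr rfl fun m _ => ?_
  have h1 : ∀ q ∈ withProfile m, q.graphZ A b x / (q.cardAut : ℂ) =
      (m.prod fun k e => x k ^ e) * (q.graphZ A b (fun _ => (1 : ℂ)) / (q.cardAut : ℂ)) := by
    intro q hq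
    rw [graphZ_eq_prod_mul, mem_withProfile.1 hq, mul_div_assoc]
    rfl
  rw [Finset.sum_congr rfl h1, ← Finset.mul_sum, sum_withProfile_graphZ_div,
    ← integral_const_mul]
  refine congrArg _ (funext fun v => ?_)
  rw [← Finsupp.prod_mul]
  refine Finsupp.prod_congr fun k _ => ?_
  rw [mul_pow, mul_div_assoc]

end

end RibbonClass

/-! ### Integrability and the remainder estimate -/

namespace CyclicAlgebra

variable {V : Type*} [NormedAddCommGroup V] [InnerProductSpace ℝ V]
  [FiniteDimensional ℝ V]

lemma polyGrowth_coeff_expSeries (A : CyclicAlgebra V) (m : ℕ+ →₀ ℕ) :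
    PolyGrowth fun v => MvPowerSeries.coeff m (A.expSeries v) := by
  simp only [A.coeff_expSeries, div_eq_mul_inv]
  exact PolyGrowth.prod _ fun k _ =>
    (((A.polyGrowth_diag k).mul (PolyGrowth.const _)).pow _).mul (PolyGrowth.const _)

lemma polyGrowth_potential (A : CyclicAlgebra V) {K : Finset ℕ+} {x : ℕ+ → ℂ}
    (hx : ∀ k, k ∉ K → x k = 0) : PolyGrowth (A.potential x) := by
  rw [show A.potential x = _ from funext fun v => A.potential_eq_sum hx v]
  simp only [div_eq_mul_inv]
  exact PolyGrowth.sum _ fun k _ =>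
    (PolyGrowth.const _).mul ((A.polyGrowth_diag k).mul (PolyGrowth.const _))

variable [MeasurableSpace V] [BorelSpace V]

lemma integrable_exp_potential (A : CyclicAlgebra V) {K : Finset ℕ+} {x : ℕ+ → ℂ}
    (hx : ∀ k, k ∉ K → x k = 0) {r B : ℝ} (hr : r < 1)
    (hb : ∀ v : V, (A.potential x v).re ≤ r * (inner ℝ v v / 2) + B) :
    Integrable (fun v => Complex.exp (A.potential x v)) (gaussianMeasure V) := by
  refine ((PolyGrowth.const (V := V) (Real.exp B)).integrable_exp_mul hr).mono'
    (Complex.continuous_exp.comp (A.polyGrowth_potential hx).1).aestronglyMeasurable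
    (Filter.Eventually.of_forall fun v => ?_)
  rw [Complex.norm_exp, ← Real.exp_add]
  exact Real.exp_le_exp.2 (hb v)

/-- The remainder of the expansion of the integral is of higher order in the coefficients. -/
lemma norm_integral_exp_potential_sub_le (A : CyclicAlgebra V) {K : Finset ℕ+} {x : ℕ+ → ℂ}
    (hx : ∀ k, k ∉ K → x k = 0) (n : ℕ) {r B : ℝ} (hr : r < 1)
    (hb : ∀ v : V, (A.potential x v).re ≤ r * (inner ℝ v v / 2) + B) :
    ‖(∫ v, Complex.exp (A.potential x v) ∂gaussianMeasure V) -
        ∫ v, ∑ j ∈ Finset.range (n + 1), A.potential x v ^ j / (j.factorial : ℂ)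
          ∂gaussianMeasure V‖ ≤
      (∫ v, ((∑ k ∈ K, ‖A.diag k v‖) ^ (n + 1) + Real.exp (r * (inner ℝ v v / 2)) *
        ((∑ k ∈ K, ‖A.diag k v‖) ^ (n + 1) * Real.exp B)) ∂gaussianMeasure V) *
        (∑ k ∈ K, ‖x k‖) ^ (n + 1) := by
  have hM : PolyGrowth fun v : V => (∑ k ∈ K, ‖A.diag k v‖) ^ (n + 1) :=
    (PolyGrowth.sum K fun k _ => (A.polyGrowth_diag k).norm).pow _
  have hp : PolyGrowth fun v : V =>
      ∑ j ∈ Finset.range (n + 1), A.potential x v ^ j / (j.factorial : ℂ) := by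
    simp only [div_eq_mul_inv]
    exact PolyGrowth.sum _ fun j _ => ((A.polyGrowth_potential hx).pow j).mul (PolyGrowth.const _)
  rw [← integral_sub (A.integrable_exp_potential hx hr hb) hp.integrable, ← integral_mul_const]
  refine norm_integral_le_of_norm_le
    ((hM.integrable.add ((hM.mul (PolyGrowth.const _)).integrable_exp_mul hr)).mul_const _)
    (Filter.Eventually.of_forall fun v => ?_)
  set S := ∑ k ∈ K, ‖x k‖
  set M := ∑ k ∈ K, ‖A.diag k v‖
  have hM0 : 0 ≤ M := Finset.sum_nonneg fun _ _ => norm_nonneg _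
  have hS0 : 0 ≤ S := Finset.sum_nonneg fun _ _ => norm_nonneg _
  calc ‖Complex.exp (A.potential x v) -
        ∑ j ∈ Finset.range (n + 1), A.potential x v ^ j / (j.factorial : ℂ)‖
      ≤ ‖A.potential x v‖ ^ (n + 1) * max 1 (Real.exp (A.potential x v).re) :=
        norm_exp_sub_sum_le_pow_mul _ _
    -- Replacing the maximum by a sum gives a majorant whose dependence on `x` is only through `S ^
    -- (n + 1)`.
    _ ≤ (S * M) ^ (n + 1) * (1 + Real.exp (r * (inner ℝ v v / 2) + B)) := by
        refine mul_le_mul (pow_le_pow_left₀ (norm_nonneg _) (A.norm_potential_le hx v) _) ?_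
          (by positivity) (by positivity)
        refine max_le (le_add_of_nonneg_right (Real.exp_pos _).le) ?_
        exact (Real.exp_le_exp.2 (hb v)).trans (le_add_of_nonneg_left zero_le_one)
    _ = _ := by
        rw [Real.exp_add, mul_pow]
        ring

end CyclicAlgebra

end

theorem theorem3 {V : Type*} [NormedAddCommGroup V] [InnerProductSpace ℝ V]
    [FiniteDimensional ℝ V] [MeasurableSpace V] [BorelSpace V]
    {ι : Type*} [Fintype ι] [DecidableEq ι] (b : Module.Basis ι ℝ V) (A : CyclicAlgebra V) :
    -- identity of formal power series in `X_1, X_2, …`, coefficient by coefficient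
    (∀ m : ℕ+ →₀ ℕ,
      Integrable (fun v => MvPowerSeries.coeff m (A.expSeries v)) (gaussianMeasure V) ∧
      (Function.support fun Γ : RibbonClass =>
        MvPowerSeries.coeff m
          ((Γ.cardAut : ℂ)⁻¹ • Γ.graphZ A b (MvPowerSeries.X (R := ℂ)))).Finite ∧
      MvPowerSeries.coeff m A.partitionSeries =
        ∑ᶠ Γ : RibbonClass, MvPowerSeries.coeff m
          ((Γ.cardAut : ℂ)⁻¹ • Γ.graphZ A b (MvPowerSeries.X (R := ℂ)))) ∧
    -- asymptotic expansion of the actual integral, in any finite set of the variables, as they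
    -- tend to `0` with the growth of the integrand uniformly under control
    (∀ (K : Finset ℕ+) (n : ℕ) (r B : ℝ), r < 1 → ∃ C : ℝ, ∀ x : ℕ+ → ℂ,
      (∀ k, k ∉ K → x k = 0) →
      (∀ v : V, (A.potential x v).re ≤ r * (inner ℝ v v / 2) + B) →
      Integrable (fun v => Complex.exp (A.potential x v)) (gaussianMeasure V) ∧
      {Γ : RibbonClass | Γ.numVertices ≤ n ∧ Γ.graphZ A b x ≠ 0}.Finite ∧
      ‖(∫ v, Complex.exp (A.potential x v) ∂gaussianMeasure V) -
          ∑ᶠ (Γ : RibbonClass) (_ : Γ.numVertices ≤ n), Γ.graphZ A b x / (Γ.cardAut : ℂ)‖ ≤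
        C * (∑ k ∈ K, ‖x k‖) ^ (n + 1)) := by
  refine ⟨fun m => ⟨(A.polyGrowth_coeff_expSeries m).integrable, ?_, ?_⟩, fun K n r B hr => ?_⟩
  · refine (RibbonClass.withProfile m).finite_toSet.subset fun q hq => ?_
    rw [Function.mem_support, RibbonClass.coeff_smul_graphZ_X] at hq
    rw [Finset.mem_coe, RibbonClass.mem_withProfile]
    by_contra h
    exact hq (if_neg h)
  · have hleft : MvPowerSeries.coeff m A.partitionSeries =
        ∫ v, MvPowerSeries.coeff m (A.expSeries v) ∂gaussianMeasure V := rfl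
    simp_rw [hleft, A.coeff_expSeries, RibbonClass.coeff_smul_graphZ_X]
    rw [← RibbonClass.sum_withProfile_graphZ_div A b m,
      finsum_eq_sum_of_support_subset (s := RibbonClass.withProfile m)]
    · refine Finset.sum_congr rfl fun q hq => ?_
      rw [if_pos (RibbonClass.mem_withProfile.1 hq)]
    · intro q hq
      rw [Finset.mem_coe, RibbonClass.mem_withProfile]
      by_contra h
      exact hq (if_neg h)
  -- The constant is the integral of the majorant from `norm_integral_exp_potential_sub_le`; it
  -- depends on `K`, `n`, `r`, `B` but not on `x`.
  · refine ⟨∫ v, ((∑ k ∈ K, ‖A.diag k v‖) ^ (n + 1) + Real.exp (r * (inner ℝ v v / 2)) *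
      ((∑ k ∈ K, ‖A.diag k v‖) ^ (n + 1) * Real.exp B)) ∂gaussianMeasure V,
      fun x hx hb => ⟨A.integrable_exp_potential hx hr hb, ?_, ?_⟩⟩
    · refine (RibbonClass.boundedBy K n).finite_toSet.subset fun q hq => ?_
      rw [Finset.mem_coe, RibbonClass.mem_boundedBy]
      exact ⟨hq.1, RibbonClass.support_profile_subset A b hx hq.2⟩
    · have hsum : ∑ᶠ (Γ : RibbonClass) (_ : Γ.numVertices ≤ n),
          Γ.graphZ A b x / (Γ.cardAut : ℂ) =
          ∑ Γ ∈ RibbonClass.boundedBy K n, Γ.graphZ A b x / (Γ.cardAut : ℂ) := by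
        -- Infinitely many classes may have at most n vertices, but those with a valence outside `K`
        -- have value 0.
        refine finsum_mem_eq_sum_of_inter_support_eq (s := {Γ : RibbonClass | Γ.numVertices ≤ n}) _ ?_
        ext q
        rw [Set.mem_inter_iff, Set.mem_inter_iff, Finset.mem_coe, RibbonClass.mem_boundedBy]
        refine ⟨fun h => ⟨⟨h.1, ?_⟩, h.2⟩, fun h => ⟨h.1.1, h.2⟩⟩
        refine RibbonClass.support_profile_subset A b hx fun h0 => h.2 ?_
        simp only [h0, zero_div]
      rw [hsum, RibbonClass.sum_boundedBy_graphZ_div A b hx]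
      exact A.norm_integral_exp_potential_sub_le hx n hr hb
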